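/- Consider a Markov decision process with finite state space $\mathscr S$ and finite action space $\mathscr A$, transition probabilities $p(s'\mid s,a)$, rewards $r(s,a,s')\in[-r_{\max},r_{\max}]$ with $r_{\max}>0$, discount factor $\gamma\in(0,1)$, a fixed initial state, and an absorbing terminal state $0\in\mathscr S$. For an episode $(S_t,A_t)_{t\ge 0}$, let $T=\min\{t: S_t=0\}$ be its length and $\sum_{t=0}^{T-1}\gamma^t r(S_t,A_t,S_{t+1})$ its cumulative reward. Let $\{\pi_\theta:\theta\in\mathbb R^d\}$ be stochastic policies and $b$ a behavior policy, and let $R^\theta$ (resp. $R^b$) be the cumulative reward of an episode generated by $\pi_\theta$ (resp. $b$). Put $M_r=r_{\max}/(1-\gamma)$. Let $g:[0,1]\to[0,1]$ be continuous and non-decreasing with $g(0)=0$, $g(1)=1$, twice differentiable on $(0,1)$ with $|g'|\le M_{g'}$ and $|g''|\le M_{g''}$ there; at $0$ and $1$, $g'$ denotes the one-sided derivative. With $F_{R^\theta}$ the distribution function of $R^\theta$, let $$\rho_g(\theta)=\int_{-M_r}^0\big(g(1-F_{R^\theta}(x))-1\big)\,dx+\int_0^{M_r}g(1-F_{R^\theta}(x))\,dx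 .$$ Assume: * the policies are proper: there is $n\ge 1$ such that $\max_{s}\mathbb P(S_n\ne 0\mid S_0=s,\pi_\theta)<1$ for all $\theta$, and there is $n\ge1$ such that $\max_s\mathbb P(S_n\neq 0\mid S_0=s,b)<1$; * $\pi_\theta(a|s)>0$ for all $\theta,s,a$, and $b(a|s)=0$ implies $\pi_\theta(a|s)=0$; * for all $s,a$ the map $\theta\mapsto\log\pi_\theta(a|s)$ is twice differentiable with $\|\nabla\log\pi_\theta(a|s)\|\le M_d$ and $\|\nabla^2\log\pi_\theta(a|s)\|\le M_h$ (operator norm) for all $\theta$; * under $b$, $T\le M_e$ almost surely, and for every $\theta$ the importance sampling ratio $\psi^\theta=\prod_{t=0}^{T-1}\frac{\pi_\theta(A_t|S_t)}{b(A_t|S_t)}$ satisfies $\psi^\theta\le M_s$ almost surely. Given $m$ episodes of $b$ with lengths $T^i$, cumulative rewards $R^b_i$ and ratios $\psi^\theta_i$, let $$H^m_{R^\theta}(x)=\min\Big\{\tfrac1m\sum_{i=1}^m\mathbf 1\{R^b_i\le x\}\psi^\theta_i,\,1\Big\},\qquad \widehat\nabla H^m_{R^\theta}(x)=\tfrac1m\sum_{i=1}^m\mathbf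 1\{R^b_i\le x\}\,\psi_i^\theta\sum_{t=0}^{T^i-1}\nabla\log\pi_\theta(A^i_t|S^i_t),$$ $$\widehat\nabla^H\rho_g(\theta)=-\int_{-M_r}^{M_r}g'\big(1-H^m_{R^\theta}(x)\big)\,\widehat\nabla H^m_{R^\theta}(x)\,dx .$$ Let $N\ge1$, $\alpha=1/\sqrt N$ and $m=\lceil\sqrt N\rceil$ (so $m=\sqrt N$ when $N$ is a perfect square). Starting from a fixed $\theta_0\in\mathbb R^d$, let $\theta_{k+1}=\theta_k+\alpha\widehat\nabla^H\rho_g(\theta_k)$ for $0\le k<N$, where each step uses a fresh batch of $m$ episodes of $b$ and all $Nm$ episodes are independent, and let $R$ be uniformly distributed on $\{1,\dots,N\}$ and independent of the episodes. Then $\rho_g$ is differentiable and bounded above, $\|\nabla\rho_g(\theta_R)\|^2$ is integrable, and, with $\rho_g^*=\sup_{\theta}\rho_g(\theta)$ and $$L_{\rho'}=2M_rM_e\big(M_hM_{g'}+M_eM_d^2(M_{g'}+M_{g''})\big),$$ $$\mathbb E\big[\|\nabla\rho_g(\theta_R)\|^2\big]\le\frac{2(\rho_g^*-\rho_g(\theta_0))}{\sqrt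 N}+\frac{4M_r^2M_s^2M_e^2M_d^2\big(M_{g'}^2L_{\rho'}+8(e^2M_{g'}^2+M_{g''}^2M_s^2)\big)}{\sqrt N}.$$ -/

import Mathlib

open MeasureTheory ProbabilityTheory

noncomputable section

/-- A finite episodic Markov decision process with discounted, bounded rewards. -/
structure EpisodicMDP (S A : Type*) where
  /-- `p s a` is the distribution of the next state after taking action `a` in state `s`. -/
  p : S → A → PMF S
  /-- `r s a s'` is the reward of the transition from `s` to `s'` under action `a`. -/
  r : S → A → S → ℝ
  /-- the fixed initial state -/
  start : S
  /-- the terminal state -/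
  terminal : S
  /-- the discount factor -/
  γ : ℝ
  /-- the bound on the one-step rewards -/
  rmax : ℝ
  absorbing : ∀ a, p terminal a = PMF.pure terminal
  γ_pos : 0 < γ
  γ_lt_one : γ < 1
  rmax_pos : 0 < rmax
  abs_r_le : ∀ s a s', |r s a s'| ≤ rmax

namespace EpisodicMDP

variable {S A : Type*} (M : EpisodicMDP S A)

/-! ### Trajectories: `ω t = (S_t, A_t)` -/

/-- The length `T` of an episode, i.e. the first time at which the terminal state is visited
(meaningful only for trajectories which visit it, see `Terminates`). -/
def length (ω : ℕ → S × A) : ℕ := sInf {t | (ω t).1 = M.terminal}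

/-- The trajectory visits the terminal state, i.e. `T < ∞`. -/
def Terminates (ω : ℕ → S × A) : Prop := ∃ t, (ω t).1 = M.terminal

/-- The cumulative discounted reward `∑_{t < T} γ^t r(S_t, A_t, S_{t+1})`. -/
def cumReward (ω : ℕ → S × A) : ℝ :=
  ∑ t ∈ Finset.range (M.length ω), M.γ ^ t * M.r (ω t).1 (ω t).2 (ω (t + 1)).1

/-- The importance sampling ratio `∏_{t < T} π(A_t | S_t) / b(A_t | S_t)`. -/
def isRatio (π b : S → PMF A) (ω : ℕ → S × A) : ℝ :=
  ∏ t ∈ Finset.range (M.length ω),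
    (π (ω t).1 (ω t).2).toReal / (b (ω t).1 (ω t).2).toReal

/-- The constant `M_r = r_max / (1 - γ)`. -/
def rewardBound : ℝ := M.rmax / (1 - M.γ)

section Law

variable [Fintype S] [Fintype A] [MeasurableSpace S] [DiscreteMeasurableSpace S]
  [MeasurableSpace A] [DiscreteMeasurableSpace A]

/-- The conditional law of `(S_{t+1}, A_{t+1})` given the history up to time `t` when the policy
`π` is followed: `S_{t+1} ∼ p(· | S_t, A_t)` and then `A_{t+1} ∼ π(· | S_{t+1})`. -/
def stepKernel (π : S → PMF A) (t : ℕ) :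
    Kernel ((_ : Finset.Iic t) → S × A) (S × A) :=
  Kernel.ofFunOfCountable fun h =>
    ((M.p (h ⟨t, Finset.mem_Iic.2 le_rfl⟩).1 (h ⟨t, Finset.mem_Iic.2 le_rfl⟩).2).bind
      fun s' => (π s').map (Prod.mk s')).toMeasure

instance (π : S → PMF A) (t : ℕ) : IsMarkovKernel (M.stepKernel π t) :=
  ⟨fun _ => by
    simp only [stepKernel, Kernel.ofFunOfCountable, Kernel.coe_mk]
    infer_instance⟩

/-- The law of the trajectory `(S_t, A_t)_{t ≥ 0}` generated by the policy `π` from `S_0 = s`. -/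
def law (π : S → PMF A) (s : S) : Measure (ℕ → S × A) :=
  Kernel.trajMeasure (X := fun _ => S × A) ((π s).map (Prod.mk s)).toMeasure (M.stepKernel π)

/-- The cumulative distribution function of the cumulative reward of the policy `π`. -/
def rewardCDF (π : S → PMF A) (x : ℝ) : ℝ :=
  (M.law π M.start).real {ω | M.cumReward ω ≤ x}

/-- The distortion risk measure of the cumulative reward of the policy `π`, for the distortion
function `g`. -/
def drm (g : ℝ → ℝ) (π : S → PMF A) : ℝ :=
  (∫ x in (-M.rewardBound)..0, (g (1 - M.rewardCDF π x) - 1)) +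
    ∫ x in (0 : ℝ)..M.rewardBound, g (1 - M.rewardCDF π x)

end Law

/-! ### The off-policy likelihood ratio algorithm -/

section Algorithm

variable {d m : ℕ} (π : EuclideanSpace ℝ (Fin d) → S → PMF A) (b : S → PMF A)

/-- `θ ↦ log π_θ(a | s)` -/
def logPolicy (s : S) (a : A) (θ : EuclideanSpace ℝ (Fin d)) : ℝ :=
  Real.log (π θ s a).toReal

/-- The score `∑_{t < T} ∇ log π_θ(A_t | S_t)` of an episode. -/
def score (θ : EuclideanSpace ℝ (Fin d)) (ω : ℕ → S × A) : EuclideanSpace ℝ (Fin d) :=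
  ∑ t ∈ Finset.range (M.length ω), gradient (logPolicy π (ω t).1 (ω t).2) θ

/-- The importance sampling estimate `H^m(x)`, capped at `1`, of the distribution function of the
cumulative reward of `π_θ` from a batch `ω` of `m` episodes of the behavior policy `b`. -/
def cdfEstimate (θ : EuclideanSpace ℝ (Fin d)) (ω : Fin m → ℕ → S × A) (x : ℝ) : ℝ :=
  min ((1 / (m : ℝ)) * ∑ i, Set.indicator {ω' | M.cumReward ω' ≤ x}
    (fun ω' => M.isRatio (π θ) b ω') (ω i)) 1

/-- The estimate of the gradient in `θ` of the distribution function of the cumulative reward. -/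
def cdfGradEstimate (θ : EuclideanSpace ℝ (Fin d)) (ω : Fin m → ℕ → S × A) (x : ℝ) :
    EuclideanSpace ℝ (Fin d) :=
  (1 / (m : ℝ)) • ∑ i, Set.indicator {ω' | M.cumReward ω' ≤ x}
    (fun ω' => M.isRatio (π θ) b ω' • M.score π θ ω') (ω i)

/-- The estimate `-∫_{-M_r}^{M_r} g'(1 - H^m(x)) ∇̂H^m(x) dx` of the gradient of the distortion risk
measure. The derivative of `g` is taken within `[0, 1]`, so it is one-sided at the end points. -/
def drmGradEstimate (g : ℝ → ℝ) (θ : EuclideanSpace ℝ (Fin d)) (ω : Fin m → ℕ → S × A) :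
    EuclideanSpace ℝ (Fin d) :=
  -∫ x in (-M.rewardBound)..M.rewardBound,
    derivWithin g (Set.Icc 0 1) (1 - M.cdfEstimate π b θ ω x) • M.cdfGradEstimate π b θ ω x

/-- The iterates `θ_{k+1} = θ_k + α ∇̂ρ_g(θ_k)`, where the `k`-th update uses the batch `ξ k` of `m`
episodes. -/
def iterate (g : ℝ → ℝ) (α : ℝ) (θ₀ : EuclideanSpace ℝ (Fin d))
    (ξ : ℕ → Fin m → ℕ → S × A) : ℕ → EuclideanSpace ℝ (Fin d)
  | 0 => θ₀
  | k + 1 => iterate g α θ₀ ξ k + α • M.drmGradEstimate π b g (iterate g α θ₀ ξ k) (ξ k)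

end Algorithm

end EpisodicMDP

end

/-!
Under the behavior policy an episode ends within `⌊Me⌋` steps, so up to the irrelevant actions taken
in the terminal state it is one of finitely many paths. Weighting these paths with the importance
sampling ratio turns the distribution function of the reward of `π_θ` into a finite sum of smooth
functions of `θ`, whose gradient is the mean of `1{R ≤ x} ψ ∑ₜ ∇ log π_θ(Aₜ | Sₜ)`. Consequently
`ρ_g` is differentiable with bounded Lipschitz gradient.

Averages over `m` independent episodes have mean squared error of order `1 / m`, and since `g'` is
Lipschitz this error rate passes to the estimate of `∇ρ_g`. The ascent inequality for functions
with Lipschitz gradient then bounds `‖∇ρ_g(θ_k)‖²` in mean by the increase of `ρ_g` along the `k`-th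
step, plus the mean squared error and a term of order `α`. The increases telescope over `k < N`.
The random index ranges over `1, …, N` instead, so the last iterate contributes one more term, which
is at most `sup ‖∇ρ_g‖² / N` and is absorbed by the slack in the variance term.
-/

noncomputable section

open Set

/-! ### Calculus -/

section Calculus

open Filter Topology

/-- A real function with bounded Lipschitz derivative on `s`, the derivative being taken within `s`:
the regularity required of a distortion function on `s = [0, 1]`. -/
structure HasBoundedLipschitzDerivOn (g : ℝ → ℝ) (s : Set ℝ) (C₁ C₂ : ℝ) : Prop where
  differentiableOn : DifferentiableOn ℝ g s
  abs_derivWithin_le : ∀ t ∈ s, |derivWithin g s t| ≤ C₁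
  abs_derivWithin_sub_le : ∀ t ∈ s, ∀ u ∈ s, |derivWithin g s t - derivWithin g s u| ≤ C₂ * |t - u|

lemma HasBoundedLipschitzDerivOn.hasDerivWithinAt {g : ℝ → ℝ} {s : Set ℝ} {C₁ C₂ t : ℝ}
    (hg : HasBoundedLipschitzDerivOn g s C₁ C₂) (ht : t ∈ s) :
    HasDerivWithinAt g (derivWithin g s t) s t :=
  (hg.differentiableOn t ht).hasDerivWithinAt

lemma HasBoundedLipschitzDerivOn.lipschitzConst_nonneg {g : ℝ → ℝ} {s : Set ℝ} {C₁ C₂ : ℝ}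
    (hg : HasBoundedLipschitzDerivOn g s C₁ C₂) (hs : s.Nontrivial) : 0 ≤ C₂ := by
  obtain ⟨t, ht, u, hu, htu⟩ := hs
  exact nonneg_of_mul_nonneg_left ((abs_nonneg _).trans (hg.abs_derivWithin_sub_le t ht u hu))
    (abs_pos.2 (sub_ne_zero.2 htu))

lemma hasDerivWithinAt_Icc_of_eqOn_deriv {g G : ℝ → ℝ} {a b : ℝ} (hab : a < b)
    (hg : ContinuousOn g (Icc a b)) (hg' : DifferentiableOn ℝ g (Ioo a b)) (hG : Continuous G)
    (hGg : EqOn (deriv g) G (Ioo a b)) {t : ℝ} (ht : t ∈ Icc a b) :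
    HasDerivWithinAt g (G t) (Icc a b) t := by
  rcases ht.1.eq_or_lt with rfl | hat
  · refine (hasDerivWithinAt_Ici_of_tendsto_deriv hg' ((hg a ht).mono Ioo_subset_Icc_self)
      (Ioo_mem_nhdsGT hab) ?_).mono Icc_subset_Ici_self
    refine (hG.continuousAt.mono_left nhdsWithin_le_nhds).congr' ?_
    filter_upwards [Ioo_mem_nhdsGT hab] with z hz using (hGg hz).symm
  rcases ht.2.eq_or_lt with rfl | htb
  · refine (hasDerivWithinAt_Iic_of_tendsto_deriv hg' ((hg t ht).mono Ioo_subset_Icc_self)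
      (Ioo_mem_nhdsLT hab) ?_).mono Icc_subset_Iic_self
    refine (hG.continuousAt.mono_left nhdsWithin_le_nhds).congr' ?_
    filter_upwards [Ioo_mem_nhdsLT hab] with z hz using (hGg hz).symm
  · rw [← hGg ⟨hat, htb⟩]
    exact ((hg' t ⟨hat, htb⟩).differentiableAt
      (Ioo_mem_nhds hat htb)).hasDerivAt.hasDerivWithinAt

lemma hasBoundedLipschitzDerivOn_Icc {g : ℝ → ℝ} {a b C₁ C₂ : ℝ} (hab : a < b)
    (hg : ContinuousOn g (Icc a b)) (hg' : DifferentiableOn ℝ g (Ioo a b))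
    (hg'' : DifferentiableOn ℝ (deriv g) (Ioo a b)) (h₁ : ∀ t ∈ Ioo a b, |deriv g t| ≤ C₁)
    (h₂ : ∀ t ∈ Ioo a b, |deriv (deriv g) t| ≤ C₂) :
    HasBoundedLipschitzDerivOn g (Icc a b) C₁ C₂ := by
  obtain ⟨c, hc⟩ := nonempty_Ioo.2 hab
  have hC₂ : 0 ≤ C₂ := (abs_nonneg _).trans (h₂ c hc)
  have hlip : LipschitzOnWith C₂.toNNReal (deriv g) (Ioo a b) :=
    (convex_Ioo a b).lipschitzOnWith_of_nnnorm_deriv_le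
      (fun t ht => (hg'' t ht).differentiableAt (isOpen_Ioo.mem_nhds ht))
      fun t ht => by simpa [← NNReal.coe_le_coe, hC₂] using h₂ t ht
  obtain ⟨G, hG, hGg⟩ := hlip.extend_real
  have hderiv : ∀ t ∈ Icc a b, HasDerivWithinAt g (G t) (Icc a b) t := fun t =>
    hasDerivWithinAt_Icc_of_eqOn_deriv hab hg hg' hG.continuous hGg
  have hderivWithin : EqOn (derivWithin g (Icc a b)) G (Icc a b) := fun t ht =>
    (hderiv t ht).derivWithin (uniqueDiffOn_Icc hab t ht)
  refine ⟨fun t ht => (hderiv t ht).differentiableWithinAt, fun t ht => ?_, fun t ht u hu => ?_⟩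
  · have hclosed : closure (Ioo a b) ⊆ {t | |G t| ≤ C₁} :=
      closure_minimal (fun t ht => (hGg ht ▸ h₁ t ht : |G t| ≤ C₁))
        (isClosed_le hG.continuous.abs continuous_const)
    rw [hderivWithin ht]
    exact hclosed (by rwa [closure_Ioo hab.ne])
  · rw [hderivWithin ht, hderivWithin hu]
    simpa [Real.dist_eq, hC₂] using hG.dist_le_mul t u

variable {E : Type*} [NormedAddCommGroup E]

lemma norm_smul_sub_smul_le [NormedSpace ℝ E] {r s r₀ δ : ℝ} {u v : E} {v₀ ε : ℝ}
    (hr : |r| ≤ r₀) (hv : ‖v‖ ≤ v₀) (hrs : |r - s| ≤ δ) (huv : ‖u - v‖ ≤ ε) :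
    ‖r • u - s • v‖ ≤ r₀ * ε + δ * v₀ := by
  calc ‖r • u - s • v‖ = ‖r • (u - v) + (r - s) • v‖ := by congr 1; module
    _ ≤ |r| * ‖u - v‖ + |r - s| * ‖v‖ := by
      simpa only [norm_smul, Real.norm_eq_abs] using norm_add_le (r • (u - v)) ((r - s) • v)
    _ ≤ r₀ * ε + δ * v₀ := by
      gcongr
      · exact (abs_nonneg r).trans hr
      · exact (abs_nonneg _).trans hrs

variable [InnerProductSpace ℝ E] [CompleteSpace E]

lemma hasGradientAt_finset_prod {ι : Type*} {f : ι → E → ℝ} {v : ι → E} {θ : E} (s : Finset ι)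
    (hf : ∀ i ∈ s, HasGradientAt (f i) (f i θ • v i) θ) :
    HasGradientAt (fun θ => ∏ i ∈ s, f i θ) ((∏ i ∈ s, f i θ) • ∑ i ∈ s, v i) θ := by
  classical
  induction s using Finset.induction_on with
  | empty => simpa using hasGradientAt_const θ (1 : ℝ)
  | insert i s hi ih =>
    have hprod := (hf i (s.mem_insert_self i)).hasFDerivAt.fun_mul
      (ih fun j hj => hf j (Finset.mem_insert_of_mem hj)).hasFDerivAt
    simp_rw [Finset.prod_insert hi, Finset.sum_insert hi]
    rw [← map_smul, ← map_smul, ← map_add] at hprod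
    rw [hasGradientAt_iff_hasFDerivAt]
    refine hprod.congr_fderiv (congrArg _ ?_)
    module

lemma hasGradientAt_intervalIntegral {F : E → ℝ → ℝ} {F' : E → ℝ → E} {a b C : ℝ}
    (hF : ∀ θ, IntervalIntegrable (F θ) volume a b)
    (hF' : ∀ θ, IntervalIntegrable (F' θ) volume a b) (hC : ∀ θ x, ‖F' θ x‖ ≤ C)
    (hgrad : ∀ θ x, HasGradientAt (F · x) (F' θ x) θ) (θ : E) :
    HasGradientAt (fun θ => ∫ x in a..b, F θ x) (∫ x in a..b, F' θ x) θ := by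
  have hdual : IntervalIntegrable (fun x => innerSL ℝ (F' θ x)) volume a b :=
    ⟨(innerSL ℝ).integrable_comp (hF' θ).1, (innerSL ℝ).integrable_comp (hF' θ).2⟩
  have hderiv : HasFDerivAt (fun θ => ∫ x in a..b, F θ x)
      (∫ x in a..b, innerSL ℝ (F' θ x)) θ :=
    intervalIntegral.hasFDerivAt_integral_of_dominated_of_fderiv_le (𝕜 := ℝ) (F := F)
      (F' := fun θ x => innerSL ℝ (F' θ x)) (bound := fun _ => C) univ_mem
      (Eventually.of_forall fun θ => (hF θ).aestronglyMeasurable_restrict_uIoc) (hF θ)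
      hdual.aestronglyMeasurable_restrict_uIoc
      (ae_of_all _ fun x _ θ _ => (innerSL_apply_norm ℝ (F' θ x)).trans_le (hC θ x)) (by simp)
      (ae_of_all _ fun x _ θ _ => (hgrad θ x).hasFDerivAt)
  rwa [ContinuousLinearMap.intervalIntegral_comp_comm _ (hF' θ)] at hderiv

end Calculus

/-! ### Square-integrable vectors -/

section SquareIntegrable

variable {V : Type*} [NormedAddCommGroup V]

lemma norm_intervalIntegral_sq_le [NormedSpace ℝ V] [CompleteSpace V] {φ : ℝ → V} {a b : ℝ}
    (hab : a < b) (hφ : IntervalIntegrable φ volume a b)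
    (hφ2 : IntervalIntegrable (fun x => ‖φ x‖ ^ 2) volume a b) :
    ‖∫ x in a..b, φ x‖ ^ 2 ≤ (b - a) * ∫ x in a..b, ‖φ x‖ ^ 2 := by
  have hba : 0 < b - a := sub_pos.2 hab
  rw [intervalIntegrable_iff_integrableOn_Ioc_of_le hab.le] at hφ hφ2
  have hconvex := (convexOn_univ_norm (E := V)).pow (fun _ _ => norm_nonneg _) 2
  have hjensen := hconvex.map_set_average_le (by fun_prop) isClosed_univ (by simp [hab]) (by simp)
    (ae_of_all _ fun _ => mem_univ _) hφ hφ2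
  simp only [Pi.pow_apply, setAverage_eq, Real.volume_real_Ioc_of_le hab.le,
    norm_smul, smul_eq_mul, mul_pow, ← intervalIntegral.integral_of_le hab.le, norm_inv,
    Real.norm_of_nonneg hba.le] at hjensen
  rw [inv_pow, inv_mul_le_iff₀ (by positivity)] at hjensen
  refine hjensen.trans_eq ?_
  field_simp

variable [InnerProductSpace ℝ V] {Ω : Type*} [MeasurableSpace Ω] {P : Measure Ω} {ι : Type*}
  [Fintype ι]

lemma integrable_inner_of_memLp_two {X Y : Ω → V} (hX : MemLp X 2 P) (hY : MemLp Y 2 P) :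
    Integrable (fun ω => inner ℝ (X ω) (Y ω)) P := by
  refine (L2.integrable_inner (𝕜 := ℝ) hX.toLp hY.toLp).congr ?_
  filter_upwards [hX.coeFn_toLp, hY.coeFn_toLp] with ω hXω hYω
  rw [hXω, hYω]

lemma integral_norm_sum_sq_of_orthogonal {Y : ι → Ω → V} (hY : ∀ i, MemLp (Y i) 2 P)
    (horth : Pairwise fun i j => ∫ ω, inner ℝ (Y i ω) (Y j ω) ∂P = 0) :
    ∫ ω, ‖∑ i, Y i ω‖ ^ 2 ∂P = ∑ i, ∫ ω, ‖Y i ω‖ ^ 2 ∂P := by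
  have hint := fun i j => integrable_inner_of_memLp_two (hY i) (hY j)
  simp_rw [← real_inner_self_eq_norm_sq, sum_inner, inner_sum]
  rw [integral_finsetSum _ fun i _ => integrable_finsetSum _ fun j _ => hint i j]
  refine Finset.sum_congr rfl fun i _ => ?_
  rw [integral_finsetSum _ fun j _ => hint i j]
  exact Finset.sum_eq_single i (fun j _ hji => horth hji.symm) (by simp)

variable [CompleteSpace V] [IsProbabilityMeasure P]

lemma integral_norm_sub_integral_sq_le {X : Ω → V} (hX : MemLp X 2 P) :
    ∫ ω, ‖X ω - ∫ ω', X ω' ∂P‖ ^ 2 ∂P ≤ ∫ ω, ‖X ω‖ ^ 2 ∂P := by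
  have hX1 : Integrable X P := hX.integrable one_le_two
  set μ := ∫ ω, X ω ∂P
  have hcross : Integrable (fun ω => 2 * inner ℝ (X ω) μ) P := (hX1.inner_const μ).const_mul 2
  have hinner : ∫ ω, inner ℝ (X ω) μ ∂P = ‖μ‖ ^ 2 := by
    simp_rw [real_inner_comm μ]
    rw [integral_inner hX1, real_inner_self_eq_norm_sq]
  calc ∫ ω, ‖X ω - μ‖ ^ 2 ∂P
      = ∫ ω, (‖X ω‖ ^ 2 - 2 * inner ℝ (X ω) μ + ‖μ‖ ^ 2) ∂P := by simp_rw [norm_sub_sq_real]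
    _ = ∫ ω, ‖X ω‖ ^ 2 ∂P - ‖μ‖ ^ 2 := by
      rw [integral_add (hX.norm.integrable_sq.sub' hcross) (integrable_const _),
        integral_sub hX.norm.integrable_sq hcross, integral_const_mul, hinner]
      simp only [integral_const, probReal_univ, one_smul]
      ring
    _ ≤ ∫ ω, ‖X ω‖ ^ 2 ∂P := sub_le_self _ (by positivity)

lemma integral_inner_sub_eq_zero_of_indepFun [MeasurableSpace V] [BorelSpace V] {X Y : Ω → V}
    (hX : Integrable X P) (hY : Integrable Y P) (hXY : IndepFun X Y P) (v : V) :
    ∫ ω, inner ℝ (X ω - ∫ ω', X ω' ∂P) (Y ω - v) ∂P = 0 := by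
  have hindep := hXY.comp (measurable_id.sub_const (∫ ω, X ω ∂P)) (measurable_id.sub_const v)
  refine (hindep.integral_bilin (hX.sub (integrable_const _)) (hY.sub (integrable_const v))
    (innerSL ℝ)).trans ?_
  simp [integral_sub hX (integrable_const _)]

lemma integral_norm_average_sub_sq_le [Nonempty ι] [MeasurableSpace V] [BorelSpace V]
    {X : ι → Ω → V} (hX : ∀ i, MemLp (X i) 2 P)
    (hindep : Pairwise fun i j => IndepFun (X i) (X j) P) {μ : V}
    (hmean : ∀ i, ∫ ω, X i ω ∂P = μ) {c : ℝ} (hc : ∀ i, ∫ ω, ‖X i ω‖ ^ 2 ∂P ≤ c) :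
    ∫ ω, ‖(1 / (Fintype.card ι : ℝ)) • ∑ i, X i ω - μ‖ ^ 2 ∂P ≤ c / Fintype.card ι := by
  have hX1 : ∀ i, Integrable (X i) P := fun i => (hX i).integrable one_le_two
  have hcard : (Fintype.card ι : ℝ) ≠ 0 := by simp
  have hcenter : ∀ ω, (1 / (Fintype.card ι : ℝ)) • ∑ i, X i ω - μ =
      (1 / (Fintype.card ι : ℝ)) • ∑ i, (X i ω - μ) := fun ω => by
    rw [Finset.sum_sub_distrib, Finset.sum_const, Finset.card_univ, ← Nat.cast_smul_eq_nsmul ℝ,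
      smul_sub, smul_smul, one_div, inv_mul_cancel₀ hcard, one_smul]
  calc ∫ ω, ‖(1 / (Fintype.card ι : ℝ)) • ∑ i, X i ω - μ‖ ^ 2 ∂P
      = (1 / (Fintype.card ι : ℝ)) ^ 2 * ∫ ω, ‖∑ i, (X i ω - μ)‖ ^ 2 ∂P := by
        simp_rw [hcenter, norm_smul, mul_pow, Real.norm_eq_abs, sq_abs, integral_const_mul]
    _ = (1 / (Fintype.card ι : ℝ)) ^ 2 * ∑ i, ∫ ω, ‖X i ω - μ‖ ^ 2 ∂P := by
        rw [integral_norm_sum_sq_of_orthogonal (Y := fun i ω => X i ω - μ)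
          fun i => (hX i).sub (memLp_const μ)]
        intro i j hij
        simpa only [hmean i] using
          integral_inner_sub_eq_zero_of_indepFun (hX1 i) (hX1 j) (hindep hij) μ
    _ ≤ (1 / (Fintype.card ι : ℝ)) ^ 2 * ∑ _i : ι, c := by
        gcongr with i
        exact (hmean i ▸ integral_norm_sub_integral_sq_le (hX i)).trans (hc i)
    _ = c / Fintype.card ι := by
        rw [Finset.sum_const, Finset.card_univ, nsmul_eq_mul]
        field_simp

end SquareIntegrable

/-! ### Random variables with finitely many values -/

section FiniteValued

variable {Ω T V : Type*} [MeasurableSpace Ω] {P : Measure Ω} [MeasurableSpace T]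
  [DiscreteMeasurableSpace T] [Finite T] [NormedAddCommGroup V]

lemma memLp_comp_of_finite [IsFiniteMeasure P] {X : Ω → T} (hX : Measurable X) (f : T → V)
    (p : ENNReal) : MemLp (fun ω => f (X ω)) p P :=
  (MemLp.of_discrete (f := f)).comp_of_map hX.aemeasurable

lemma integrable_comp_of_finite [IsFiniteMeasure P] {X : Ω → T} (hX : Measurable X) (f : T → V) :
    Integrable (fun ω => f (X ω)) P :=
  memLp_one_iff_integrable.1 (memLp_comp_of_finite hX f 1)

lemma integral_comp_of_discrete [NormedSpace ℝ V] {X : Ω → T} (hX : Measurable X) (f : T → V) :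
    ∫ ω, f (X ω) ∂P = ∫ t, f t ∂P.map X :=
  (integral_map hX.aemeasurable StronglyMeasurable.of_discrete.aestronglyMeasurable).symm

lemma integral_le_of_indepFun {T' : Type*} [MeasurableSpace T'] [DiscreteMeasurableSpace T']
    [Finite T'] [IsProbabilityMeasure P] {X : Ω → T} {Y : Ω → T'} (hX : Measurable X)
    (hY : Measurable Y) (hXY : IndepFun X Y P) {f : T → T' → ℝ} {c : ℝ}
    (hf : ∀ t, ∫ ω, f t (Y ω) ∂P ≤ c) : ∫ ω, f (X ω) (Y ω) ∂P ≤ c := by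
  have : IsProbabilityMeasure (P.map X) := Measure.isProbabilityMeasure_map hX.aemeasurable
  have : IsProbabilityMeasure (P.map Y) := Measure.isProbabilityMeasure_map hY.aemeasurable
  calc ∫ ω, f (X ω) (Y ω) ∂P
      = ∫ t, ∫ t', f t t' ∂P.map Y ∂P.map X := by
        rw [integral_comp_of_discrete (hX.prodMk hY) fun z : T × T' => f z.1 z.2,
          hXY.map_prod_eq_prod_map_map hX.aemeasurable hY.aemeasurable, integral_prod _ .of_finite]
    _ ≤ ∫ _t, c ∂P.map X := by
        refine integral_mono .of_finite (integrable_const c) fun t => ?_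
        simpa only [integral_comp_of_discrete hY] using hf t
    _ = c := by simp

end FiniteValued

lemma intervalIntegrable_of_factorsThrough_sublevel {T W : Type*} [Finite T]
    [NormedAddCommGroup W] (X : T → ℝ) {f : ℝ → W}
    (hf : f.FactorsThrough fun x => {t | X t ≤ x}) (a b : ℝ) :
    IntervalIntegrable f volume a b := by
  obtain ⟨φ, rfl⟩ := (Function.factorsThrough_iff f).1 hf
  obtain ⟨C, hC⟩ := (Set.finite_range fun s => ‖φ s‖).bddAbove
  have hmeas : Measurable fun x => {t | X t ≤ x} :=
    measurable_set_iff.2 fun t => measurableSet_Ici.mem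
  rw [intervalIntegrable_iff]
  exact Measure.integrableOn_of_bounded (by simp)
    ((StronglyMeasurable.of_discrete (f := φ)).comp_measurable hmeas).aestronglyMeasurable
    (ae_of_all _ fun x => hC ⟨_, rfl⟩)

section FiniteIntegrals

variable {T V : Type*} [MeasurableSpace T] [DiscreteMeasurableSpace T] [Finite T]
  [NormedAddCommGroup V] [NormedSpace ℝ V] [CompleteSpace V]

lemma hasFDerivAt_integral_of_finite {E : Type*} [NormedAddCommGroup E] [NormedSpace ℝ E]
    {μ : Measure T} [IsFiniteMeasure μ] {f : E → T → V} {f' : T → E →L[ℝ] V} {θ : E}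
    (hf : ∀ t, HasFDerivAt (f · t) (f' t) θ) :
    HasFDerivAt (fun θ => ∫ t, f θ t ∂μ) (∫ t, f' t ∂μ) θ := by
  cases nonempty_fintype T
  simp_rw [integral_fintype (μ := μ) .of_finite]
  exact HasFDerivAt.fun_sum fun t _ => (hf t).const_smul _

lemma integral_intervalIntegral_swap_of_finite {Ω : Type*} [MeasurableSpace Ω] {P : Measure Ω}
    [IsFiniteMeasure P] {X : Ω → T} (hX : Measurable X) {f : T → ℝ → V} {a b : ℝ}
    (hf : ∀ t, IntervalIntegrable (f t) volume a b) :
    ∫ ω, (∫ x in a..b, f (X ω) x) ∂P = ∫ x in a..b, ∫ ω, f (X ω) x ∂P := by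
  cases nonempty_fintype T
  simp_rw [integral_comp_of_discrete hX fun t => ∫ x in a..b, f t x,
    fun x => integral_comp_of_discrete (P := P) hX fun t => f t x,
    integral_fintype (μ := P.map X) .of_finite]
  rw [intervalIntegral.integral_finsetSum fun t _ => (hf t).continuousOn_smul continuousOn_const]
  simp_rw [intervalIntegral.integral_smul]

end FiniteIntegrals

/-! ### Samples -/

/-- The variables `η i` form a sample of the distribution `μ`. Pairwise independence is enough for
the mean squared error of averages. -/
structure IsSample {Ω T ι : Type*} [MeasurableSpace Ω] [MeasurableSpace T] (η : ι → Ω → T)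
    (μ : Measure T) (P : Measure Ω) : Prop where
  measurable : ∀ i, Measurable (η i)
  map_eq : ∀ i, P.map (η i) = μ
  indepFun : Pairwise fun i j => IndepFun (η i) (η j) P

namespace IsSample

variable {Ω T ι : Type*} [MeasurableSpace Ω] [MeasurableSpace T] {η : ι → Ω → T} {μ : Measure T}
  {P : Measure Ω}

lemma comp {T' : Type*} [MeasurableSpace T'] (hη : IsSample η μ P) {f : T → T'}
    (hf : Measurable f) : IsSample (fun i ω => f (η i ω)) (μ.map f) P where
  measurable i := hf.comp (hη.measurable i)
  map_eq i := by rw [← hη.map_eq i, Measure.map_map hf (hη.measurable i)]; rfl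
  indepFun _ _ hij := (hη.indepFun hij).comp hf hf

lemma ae_forall [Countable ι] (hη : IsSample η μ P) {p : T → Prop} (hp : ∀ᵐ t ∂μ, p t) :
    ∀ᵐ ω ∂P, ∀ i, p (η i ω) :=
  ae_all_iff.2 fun i => ae_of_ae_map (hη.measurable i).aemeasurable ((hη.map_eq i).symm ▸ hp)

lemma integral_comp [DiscreteMeasurableSpace T] [Finite T] {V : Type*} [NormedAddCommGroup V]
    [NormedSpace ℝ V] (hη : IsSample η μ P) (f : T → V) (i : ι) :
    ∫ ω, f (η i ω) ∂P = ∫ t, f t ∂μ := by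
  rw [integral_comp_of_discrete (hη.measurable i), hη.map_eq]

lemma integral_norm_average_sub_sq_le [DiscreteMeasurableSpace T] [Finite T]
    [IsProbabilityMeasure P] [Fintype ι] [Nonempty ι] {V : Type*} [NormedAddCommGroup V]
    [InnerProductSpace ℝ V] [CompleteSpace V] (hη : IsSample η μ P) {f : T → V} {c : ℝ}
    (hf : ∀ᵐ t ∂μ, ‖f t‖ ≤ c) :
    ∫ ω, ‖(1 / (Fintype.card ι : ℝ)) • ∑ i, f (η i ω) - ∫ t, f t ∂μ‖ ^ 2 ∂P ≤
      c ^ 2 / Fintype.card ι := by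
  borelize V
  refine _root_.integral_norm_average_sub_sq_le (X := fun i ω => f (η i ω))
    (fun i => memLp_comp_of_finite (hη.measurable i) f 2)
    (fun i j hij => (hη.indepFun hij).comp .of_discrete .of_discrete)
    (fun i => hη.integral_comp f i) fun i => ?_
  calc ∫ ω, ‖f (η i ω)‖ ^ 2 ∂P ≤ ∫ _ω, c ^ 2 ∂P := by
        refine integral_mono_ae (integrable_comp_of_finite (hη.measurable i) fun t => ‖f t‖ ^ 2)
          (integrable_const _) ?_
        filter_upwards [hη.ae_forall hf] with ω hω
        have := hω i
        gcongr
    _ = c ^ 2 := by simp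

end IsSample

/-! ### Importance sampling -/

/-- Finitely many episodes distributed according to a behavior law `μ`, whose likelihood ratios
`ratio θ` turn `μ` into the law of a policy with parameter `θ`; `score θ` is the gradient of the
logarithm of `ratio θ`. The uniform bounds only concern the episodes charged by `μ`. -/
structure ImportanceModel (H E : Type*) [MeasurableSpace H] [NormedAddCommGroup E]
    [InnerProductSpace ℝ E] [CompleteSpace E] where
  μ : Measure H
  reward : H → ℝ
  ratio : E → H → ℝ
  score : E → H → E
  ratioBound : ℝ
  scoreBound : ℝ
  scoreDerivBound : ℝ
  isProbabilityMeasure : IsProbabilityMeasure μ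
  ratio_nonneg : ∀ θ h, 0 ≤ ratio θ h
  integral_ratio : ∀ θ, ∫ h, ratio θ h ∂μ = 1
  ae_ratio_le : ∀ᵐ h ∂μ, ∀ θ, ratio θ h ≤ ratioBound
  hasGradientAt_ratio : ∀ θ h, HasGradientAt (ratio · h) (ratio θ h • score θ h) θ
  ae_norm_score_le : ∀ᵐ h ∂μ, ∀ θ, ‖score θ h‖ ≤ scoreBound
  differentiable_score : ∀ h, Differentiable ℝ (score · h)
  ae_norm_fderiv_score_le : ∀ᵐ h ∂μ, ∀ θ, ‖fderiv ℝ (score · h) θ‖ ≤ scoreDerivBound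

namespace ImportanceModel

variable {H E : Type*} [MeasurableSpace H] [NormedAddCommGroup E] [InnerProductSpace ℝ E]
  [CompleteSpace E] (m : ImportanceModel H E)

attribute [instance] isProbabilityMeasure

lemma scoreBound_nonneg : 0 ≤ m.scoreBound :=
  let ⟨_, hh⟩ := m.ae_norm_score_le.exists
  (norm_nonneg _).trans (hh 0)

lemma scoreDerivBound_nonneg : 0 ≤ m.scoreDerivBound :=
  let ⟨_, hh⟩ := m.ae_norm_fderiv_score_le.exists
  (norm_nonneg _).trans (hh 0)

lemma norm_ratio_smul_score_le {θ : E} {h : H} (hh : ‖m.score θ h‖ ≤ m.scoreBound) :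
    ‖m.ratio θ h • m.score θ h‖ ≤ m.ratio θ h * m.scoreBound := by
  rw [norm_smul, Real.norm_of_nonneg (m.ratio_nonneg θ h)]
  exact mul_le_mul_of_nonneg_left hh (m.ratio_nonneg θ h)

/-- The episodes of reward at most `x`. -/
def sublevel (x : ℝ) : Set H := {h | m.reward h ≤ x}

/-- The distribution function of the reward of the policy with parameter `θ`. -/
def cdf (θ : E) (x : ℝ) : ℝ := ∫ h in m.sublevel x, m.ratio θ h ∂m.μ

/-- The gradient of `cdf` with respect to the parameter. -/
def cdfGrad (θ : E) (x : ℝ) : E := ∫ h in m.sublevel x, m.ratio θ h • m.score θ h ∂m.μ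

/-- The gradient of the distortion risk measure of the reward, for a reward in `[-r, r]`. -/
def riskGrad (g : ℝ → ℝ) (r : ℝ) (θ : E) : E :=
  -∫ x in (-r)..r, derivWithin g (Icc 0 1) (1 - m.cdf θ x) • m.cdfGrad θ x

variable {g : ℝ → ℝ} {C₁ C₂ r : ℝ}

lemma lipschitzConst_riskGrad_nonneg (hg : HasBoundedLipschitzDerivOn g (Icc 0 1) C₁ C₂)
    (hr : 0 ≤ r) :
    0 ≤ 2 * r * (C₁ * (m.scoreDerivBound + m.scoreBound ^ 2) + C₂ * m.scoreBound ^ 2) := by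
  have hC₁ : 0 ≤ C₁ := (abs_nonneg _).trans (hg.abs_derivWithin_le 0 (by simp))
  have hC₂ : 0 ≤ C₂ := hg.lipschitzConst_nonneg ⟨0, by simp, 1, by simp, zero_ne_one⟩
  have := m.scoreDerivBound_nonneg
  positivity

section Risk

variable [Finite H]

lemma intervalIntegrable_riskGrad (g : ℝ → ℝ) (θ : E) (a b : ℝ) :
    IntervalIntegrable (fun x => derivWithin g (Icc 0 1) (1 - m.cdf θ x) • m.cdfGrad θ x)
      volume a b :=
  intervalIntegrable_of_factorsThrough_sublevel m.reward
    (fun x y (hxy : m.sublevel x = m.sublevel y) => by simp only [cdf, cdfGrad, hxy]) a b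

variable [DiscreteMeasurableSpace H]

lemma one_le_ratioBound : 1 ≤ m.ratioBound := by
  calc 1 = ∫ h, m.ratio 0 h ∂m.μ := (m.integral_ratio 0).symm
    _ ≤ ∫ _h, m.ratioBound ∂m.μ :=
      integral_mono_ae .of_finite .of_finite (m.ae_ratio_le.mono fun h hh => hh 0)
    _ = m.ratioBound := by simp

lemma norm_setIntegral_le {V : Type*} [NormedAddCommGroup V] [NormedSpace ℝ V] {f : H → V} {c : ℝ}
    (θ : E) (s : Set H) (hf : ∀ᵐ h ∂m.μ, ‖f h‖ ≤ m.ratio θ h * c) : ‖∫ h in s, f h ∂m.μ‖ ≤ c := by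
  calc ‖∫ h in s, f h ∂m.μ‖ ≤ ∫ h in s, ‖f h‖ ∂m.μ := norm_integral_le_integral_norm _
    _ ≤ ∫ h, ‖f h‖ ∂m.μ := setIntegral_le_integral .of_finite (ae_of_all _ fun h => norm_nonneg _)
    _ ≤ ∫ h, m.ratio θ h * c ∂m.μ := integral_mono_ae .of_finite .of_finite hf
    _ = c := by rw [integral_mul_const, m.integral_ratio, one_mul]

lemma cdf_le_one (θ : E) (x : ℝ) : m.cdf θ x ≤ 1 :=
  (le_abs_self _).trans (m.norm_setIntegral_le θ _ (ae_of_all _ fun h => by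
    rw [Real.norm_of_nonneg (m.ratio_nonneg θ h), mul_one]))

lemma one_sub_cdf_mem_Icc (θ : E) (x : ℝ) : 1 - m.cdf θ x ∈ Icc (0 : ℝ) 1 :=
  ⟨sub_nonneg.2 (m.cdf_le_one θ x), sub_le_self _ (integral_nonneg (m.ratio_nonneg θ))⟩

lemma norm_cdfGrad_le (θ : E) (x : ℝ) : ‖m.cdfGrad θ x‖ ≤ m.scoreBound :=
  m.norm_setIntegral_le θ _ (m.ae_norm_score_le.mono fun _ hh => m.norm_ratio_smul_score_le (hh θ))

lemma hasGradientAt_cdf (θ : E) (x : ℝ) : HasGradientAt (m.cdf · x) (m.cdfGrad θ x) θ := by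
  have hderiv := hasFDerivAt_integral_of_finite (μ := m.μ.restrict (m.sublevel x))
    fun h => (m.hasGradientAt_ratio θ h).hasFDerivAt
  rw [hasGradientAt_iff_hasFDerivAt]
  exact hderiv.congr_fderiv (ContinuousLinearMap.integral_comp_comm (innerSL ℝ) .of_finite)

lemma abs_cdf_sub_le (x : ℝ) (θ θ' : E) : |m.cdf θ x - m.cdf θ' x| ≤ m.scoreBound * ‖θ - θ'‖ :=
  convex_univ.norm_image_sub_le_of_norm_hasFDerivWithin_le
    (fun θ _ => (m.hasGradientAt_cdf θ x).hasFDerivAt.hasFDerivWithinAt)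
    (fun θ _ => by simpa using m.norm_cdfGrad_le θ x) (mem_univ _) (mem_univ _)

lemma norm_cdfGrad_sub_le (x : ℝ) (θ θ' : E) :
    ‖m.cdfGrad θ x - m.cdfGrad θ' x‖ ≤
      (m.scoreDerivBound + m.scoreBound ^ 2) * ‖θ - θ'‖ := by
  have hderiv := fun θ => hasFDerivAt_integral_of_finite (μ := m.μ.restrict (m.sublevel x))
    fun h => (m.hasGradientAt_ratio θ h).hasFDerivAt.fun_smul
      (m.differentiable_score h θ).hasFDerivAt
  refine convex_univ.norm_image_sub_le_of_norm_hasFDerivWithin_le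
    (fun θ _ => (hderiv θ).hasFDerivWithinAt) (fun θ _ => m.norm_setIntegral_le θ _ ?_)
    (mem_univ _) (mem_univ _)
  filter_upwards [m.ae_norm_score_le, m.ae_norm_fderiv_score_le] with h hscore hfderiv
  calc _ ≤ m.ratio θ h * ‖fderiv ℝ (m.score · h) θ‖ +
        ‖m.ratio θ h • m.score θ h‖ * ‖m.score θ h‖ := by
        refine (norm_add_le _ _).trans_eq ?_
        rw [norm_smul, Real.norm_of_nonneg (m.ratio_nonneg θ h),
          ContinuousLinearMap.norm_smulRight_apply, LinearIsometryEquiv.norm_map]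
    _ ≤ m.ratio θ h * m.scoreDerivBound + m.ratio θ h * m.scoreBound * m.scoreBound := by
        have := m.ratio_nonneg θ h
        have := m.scoreBound_nonneg
        gcongr
        exacts [hfderiv θ, m.norm_ratio_smul_score_le (hscore θ), hscore θ]
    _ = _ := by ring

lemma norm_derivWithin_smul_cdfGrad_le (hg : HasBoundedLipschitzDerivOn g (Icc 0 1) C₁ C₂) (θ : E)
    (x : ℝ) :
    ‖derivWithin g (Icc 0 1) (1 - m.cdf θ x) • m.cdfGrad θ x‖ ≤ C₁ * m.scoreBound := by
  have hC₁ := hg.abs_derivWithin_le _ (m.one_sub_cdf_mem_Icc θ x)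
  rw [norm_smul]
  exact mul_le_mul hC₁ (m.norm_cdfGrad_le θ x) (norm_nonneg _) ((abs_nonneg _).trans hC₁)

lemma hasGradientAt_integral_comp_cdf (hg : HasBoundedLipschitzDerivOn g (Icc 0 1) C₁ C₂) (r : ℝ)
    (θ : E) :
    HasGradientAt (fun θ => ∫ x in (-r)..r, g (1 - m.cdf θ x)) (m.riskGrad g r θ) θ := by
  rw [riskGrad, ← intervalIntegral.integral_neg]
  refine hasGradientAt_intervalIntegral (C := C₁ * m.scoreBound)
    (fun θ => intervalIntegrable_of_factorsThrough_sublevel m.reward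
      (fun x y (hxy : m.sublevel x = m.sublevel y) => by simp only [cdf, hxy]) _ _)
    (fun θ => (m.intervalIntegrable_riskGrad g θ _ _).neg)
    (fun θ x => (norm_neg _).trans_le (m.norm_derivWithin_smul_cdfGrad_le hg θ x))
    (fun θ x => ?_) θ
  have hchain := (hg.hasDerivWithinAt (m.one_sub_cdf_mem_Icc θ x)).comp_hasFDerivWithinAt θ
    ((m.hasGradientAt_cdf θ x).hasFDerivAt.const_sub 1).hasFDerivWithinAt (s := univ)
    fun θ _ => m.one_sub_cdf_mem_Icc θ x
  rw [hasGradientAt_iff_hasFDerivAt, ← hasFDerivWithinAt_univ]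
  exact hchain.congr_fderiv (by simp)

lemma norm_riskGrad_le (hg : HasBoundedLipschitzDerivOn g (Icc 0 1) C₁ C₂) (hr : 0 ≤ r) (θ : E) :
    ‖m.riskGrad g r θ‖ ≤ 2 * r * C₁ * m.scoreBound := by
  rw [riskGrad, norm_neg]
  refine (intervalIntegral.norm_integral_le_of_norm_le_const fun x _ =>
    m.norm_derivWithin_smul_cdfGrad_le hg θ x).trans_eq ?_
  rw [abs_of_nonneg (by linarith)]
  ring

lemma norm_riskGrad_sub_le (hg : HasBoundedLipschitzDerivOn g (Icc 0 1) C₁ C₂) (hr : 0 ≤ r)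
    (θ θ' : E) :
    ‖m.riskGrad g r θ - m.riskGrad g r θ'‖ ≤
      2 * r * (C₁ * (m.scoreDerivBound + m.scoreBound ^ 2) + C₂ * m.scoreBound ^ 2) *
        ‖θ - θ'‖ := by
  rw [riskGrad, riskGrad, neg_sub_neg, norm_sub_rev, ← intervalIntegral.integral_sub
    (m.intervalIntegrable_riskGrad g θ _ _) (m.intervalIntegrable_riskGrad g θ' _ _)]
  refine (intervalIntegral.norm_integral_le_of_norm_le_const fun x _ =>
    norm_smul_sub_smul_le (hg.abs_derivWithin_le _ (m.one_sub_cdf_mem_Icc θ x))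
      (m.norm_cdfGrad_le θ' x) (δ := C₂ * (m.scoreBound * ‖θ - θ'‖)) ?_
      (m.norm_cdfGrad_sub_le x θ θ')).trans_eq ?_
  · refine (hg.abs_derivWithin_sub_le _ (m.one_sub_cdf_mem_Icc θ x) _
      (m.one_sub_cdf_mem_Icc θ' x)).trans ?_
    have := hg.lipschitzConst_nonneg ⟨0, by simp, 1, by simp, zero_ne_one⟩
    gcongr
    rw [sub_sub_sub_cancel_left, abs_sub_comm]
    exact m.abs_cdf_sub_le x θ θ'
  · rw [abs_of_nonneg (by linarith)]
    ring

end Risk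

section Estimates

variable {ι : Type*} [Fintype ι]

/-- The unbiased estimate of `cdf` from a batch of episodes; it may exceed `1`. -/
def uncappedCdfEst (θ : E) (z : ι → H) (x : ℝ) : ℝ :=
  (1 / (Fintype.card ι : ℝ)) * ∑ i, (m.sublevel x).indicator (m.ratio θ) (z i)

/-- The estimate of `cdf` from a batch of episodes, capped at `1`. -/
def cdfEst (θ : E) (z : ι → H) (x : ℝ) : ℝ := min (m.uncappedCdfEst θ z x) 1

/-- The estimate of `cdfGrad` from a batch of episodes. -/
def cdfGradEst (θ : E) (z : ι → H) (x : ℝ) : E :=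
  (1 / (Fintype.card ι : ℝ)) •
    ∑ i, (m.sublevel x).indicator (fun h => m.ratio θ h • m.score θ h) (z i)

/-- The estimate of `riskGrad` from a batch of episodes. -/
def riskGradEst (g : ℝ → ℝ) (r : ℝ) (θ : E) (z : ι → H) : E :=
  -∫ x in (-r)..r, derivWithin g (Icc 0 1) (1 - m.cdfEst θ z x) • m.cdfGradEst θ z x

/-- The pointwise error of the integrand of `riskGradEst`. -/
def integrandError (g : ℝ → ℝ) (θ : E) (z : ι → H) (x : ℝ) : E :=
  derivWithin g (Icc 0 1) (1 - m.cdfEst θ z x) • m.cdfGradEst θ z x -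
    derivWithin g (Icc 0 1) (1 - m.cdf θ x) • m.cdfGrad θ x

lemma one_sub_cdfEst_mem_Icc (θ : E) (z : ι → H) (x : ℝ) :
    1 - m.cdfEst θ z x ∈ Icc (0 : ℝ) 1 := by
  have hest : 0 ≤ m.uncappedCdfEst θ z x := mul_nonneg (by positivity)
    (Finset.sum_nonneg fun i _ => indicator_nonneg (fun h _ => m.ratio_nonneg θ h) _)
  exact ⟨sub_nonneg.2 (min_le_right _ _), sub_le_self _ (le_min hest zero_le_one)⟩

lemma norm_indicator_ratio_smul_score_le {θ : E} {h : H} (hratio : m.ratio θ h ≤ m.ratioBound)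
    (hscore : ‖m.score θ h‖ ≤ m.scoreBound) (s : Set H) :
    ‖s.indicator (fun h => m.ratio θ h • m.score θ h) h‖ ≤ m.ratioBound * m.scoreBound :=
  (norm_indicator_le_norm_self _ h).trans <| (m.norm_ratio_smul_score_le hscore).trans <|
    mul_le_mul_of_nonneg_right hratio m.scoreBound_nonneg

lemma norm_cdfGradEst_le [Nonempty ι] {θ : E} {z : ι → H}
    (hratio : ∀ i, m.ratio θ (z i) ≤ m.ratioBound) (hscore : ∀ i, ‖m.score θ (z i)‖ ≤ m.scoreBound)
    (x : ℝ) : ‖m.cdfGradEst θ z x‖ ≤ m.ratioBound * m.scoreBound := by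
  rw [cdfGradEst, norm_smul, Real.norm_of_nonneg (by positivity), one_div,
    inv_mul_le_iff₀ (by positivity)]
  refine (norm_sum_le_of_le _ fun i _ =>
    m.norm_indicator_ratio_smul_score_le (hratio i) (hscore i) _).trans_eq ?_
  rw [Finset.sum_const, Finset.card_univ, nsmul_eq_mul]

lemma norm_riskGradEst_le [Nonempty ι] (hg : HasBoundedLipschitzDerivOn g (Icc 0 1) C₁ C₂)
    (hr : 0 ≤ r) {θ : E} {z : ι → H} (hratio : ∀ i, m.ratio θ (z i) ≤ m.ratioBound)
    (hscore : ∀ i, ‖m.score θ (z i)‖ ≤ m.scoreBound) :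
    ‖m.riskGradEst g r θ z‖ ≤ 2 * r * C₁ * (m.ratioBound * m.scoreBound) := by
  rw [riskGradEst, norm_neg]
  refine (intervalIntegral.norm_integral_le_of_norm_le_const
    (C := C₁ * (m.ratioBound * m.scoreBound)) fun x _ => ?_).trans_eq ?_
  · have hC₁ := hg.abs_derivWithin_le _ (m.one_sub_cdfEst_mem_Icc θ z x)
    rw [norm_smul]
    exact mul_le_mul hC₁ (m.norm_cdfGradEst_le hratio hscore x) (norm_nonneg _)
      ((abs_nonneg _).trans hC₁)
  · rw [abs_of_nonneg (by linarith)]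
    ring

variable [Finite H]

lemma intervalIntegrable_integrandError (g : ℝ → ℝ) (θ : E) (z : ι → H) (a b : ℝ) :
    IntervalIntegrable (m.integrandError g θ z) volume a b :=
  intervalIntegrable_of_factorsThrough_sublevel m.reward
    (fun x y (hxy : m.sublevel x = m.sublevel y) => by
      simp only [integrandError, cdf, cdfGrad, cdfEst, uncappedCdfEst, cdfGradEst, hxy]) a b

lemma intervalIntegrable_norm_integrandError_sq (g : ℝ → ℝ) (θ : E) (z : ι → H) (a b : ℝ) :
    IntervalIntegrable (fun x => ‖m.integrandError g θ z x‖ ^ 2) volume a b :=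
  intervalIntegrable_of_factorsThrough_sublevel m.reward
    (fun x y (hxy : m.sublevel x = m.sublevel y) => by
      simp only [integrandError, cdf, cdfGrad, cdfEst, uncappedCdfEst, cdfGradEst, hxy]) a b

lemma riskGradEst_sub_riskGrad (g : ℝ → ℝ) (r : ℝ) (θ : E) (z : ι → H) :
    m.riskGradEst g r θ z - m.riskGrad g r θ = -∫ x in (-r)..r, m.integrandError g θ z x := by
  have hest : IntervalIntegrable
      (fun x => derivWithin g (Icc 0 1) (1 - m.cdfEst θ z x) • m.cdfGradEst θ z x)
      volume (-r) r :=
    intervalIntegrable_of_factorsThrough_sublevel m.reward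
      (fun x y (hxy : m.sublevel x = m.sublevel y) => by
        simp only [cdfEst, uncappedCdfEst, cdfGradEst, hxy]) _ _
  unfold integrandError
  rw [intervalIntegral.integral_sub hest (m.intervalIntegrable_riskGrad g θ _ _), riskGradEst,
    riskGrad]
  abel

lemma norm_riskGradEst_sub_sq_le (hr : 0 < r) (g : ℝ → ℝ) (θ : E) (z : ι → H) :
    ‖m.riskGradEst g r θ z - m.riskGrad g r θ‖ ^ 2 ≤
      2 * r * ∫ x in (-r)..r, ‖m.integrandError g θ z x‖ ^ 2 := by
  rw [riskGradEst_sub_riskGrad, norm_neg, two_mul, ← sub_neg_eq_add]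
  exact norm_intervalIntegral_sq_le (neg_lt_self hr) (m.intervalIntegrable_integrandError g θ z _ _)
    (m.intervalIntegrable_norm_integrandError_sq g θ z _ _)

variable [DiscreteMeasurableSpace H]

lemma norm_integrandError_sq_le (hg : HasBoundedLipschitzDerivOn g (Icc 0 1) C₁ C₂) (θ : E)
    (z : ι → H) (x : ℝ) :
    ‖m.integrandError g θ z x‖ ^ 2 ≤
      2 * C₁ ^ 2 * ‖m.cdfGradEst θ z x - m.cdfGrad θ x‖ ^ 2 +
        2 * C₂ ^ 2 * m.scoreBound ^ 2 * (m.uncappedCdfEst θ z x - m.cdf θ x) ^ 2 := by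
  set δ := ‖m.cdfGradEst θ z x - m.cdfGrad θ x‖
  rw [← sq_abs (m.uncappedCdfEst θ z x - m.cdf θ x)]
  set ε := |m.uncappedCdfEst θ z x - m.cdf θ x|
  have hcap : |m.cdfEst θ z x - m.cdf θ x| ≤ ε := by
    rw [← min_eq_left (m.cdf_le_one θ x)]
    exact abs_inf_sub_inf_le_abs _ _ _
  have hlip : ‖m.integrandError g θ z x‖ ≤ C₁ * δ + C₂ * ε * m.scoreBound := by
    refine norm_smul_sub_smul_le (hg.abs_derivWithin_le _ (m.one_sub_cdfEst_mem_Icc θ z x))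
      (m.norm_cdfGrad_le θ x) ?_ le_rfl
    refine (hg.abs_derivWithin_sub_le _ (m.one_sub_cdfEst_mem_Icc θ z x) _
      (m.one_sub_cdf_mem_Icc θ x)).trans ?_
    have := hg.lipschitzConst_nonneg ⟨0, by simp, 1, by simp, zero_ne_one⟩
    rw [sub_sub_sub_cancel_left, abs_sub_comm]
    gcongr
  calc ‖m.integrandError g θ z x‖ ^ 2 ≤ (C₁ * δ + C₂ * ε * m.scoreBound) ^ 2 := by gcongr
    _ ≤ 2 * ((C₁ * δ) ^ 2 + (C₂ * ε * m.scoreBound) ^ 2) := add_sq_le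
    _ = _ := by ring

variable {Ω : Type*} [MeasurableSpace Ω] {P : Measure Ω} [IsProbabilityMeasure P]
  {η : ι → Ω → H} [Nonempty ι]

lemma integral_norm_cdfGradEst_sub_sq_le (hη : IsSample η m.μ P) (θ : E) (x : ℝ) :
    ∫ ω, ‖m.cdfGradEst θ (fun i => η i ω) x - m.cdfGrad θ x‖ ^ 2 ∂P ≤
      (m.ratioBound * m.scoreBound) ^ 2 / Fintype.card ι := by
  rw [cdfGrad, ← integral_indicator .of_discrete]
  refine hη.integral_norm_average_sub_sq_le ?_
  filter_upwards [m.ae_ratio_le, m.ae_norm_score_le] with h hratio hscore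
  exact m.norm_indicator_ratio_smul_score_le (hratio θ) (hscore θ) _

lemma integral_uncappedCdfEst_sub_sq_le (hη : IsSample η m.μ P) (θ : E) (x : ℝ) :
    ∫ ω, (m.uncappedCdfEst θ (fun i => η i ω) x - m.cdf θ x) ^ 2 ∂P ≤
      m.ratioBound ^ 2 / Fintype.card ι := by
  simp_rw [← sq_abs (_ - m.cdf θ x)]
  rw [cdf, ← integral_indicator .of_discrete]
  refine hη.integral_norm_average_sub_sq_le (V := ℝ) (m.ae_ratio_le.mono fun h hratio => ?_)
  refine (norm_indicator_le_norm_self _ h).trans ?_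
  rw [Real.norm_of_nonneg (m.ratio_nonneg θ h)]
  exact hratio θ

lemma integral_norm_integrandError_sq_le (hg : HasBoundedLipschitzDerivOn g (Icc 0 1) C₁ C₂)
    (hη : IsSample η m.μ P) (θ : E) (x : ℝ) :
    ∫ ω, ‖m.integrandError g θ (fun i => η i ω) x‖ ^ 2 ∂P ≤
      2 * m.ratioBound ^ 2 * m.scoreBound ^ 2 * (C₁ ^ 2 + C₂ ^ 2) / Fintype.card ι := by
  have hmeas : Measurable fun ω i => η i ω := measurable_pi_lambda _ hη.measurable
  have hgrad := (integrable_comp_of_finite (P := P) hmeas fun z =>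
    ‖m.cdfGradEst θ z x - m.cdfGrad θ x‖ ^ 2).const_mul (2 * C₁ ^ 2)
  have hcdf := (integrable_comp_of_finite (P := P) hmeas fun z =>
    (m.uncappedCdfEst θ z x - m.cdf θ x) ^ 2).const_mul (2 * C₂ ^ 2 * m.scoreBound ^ 2)
  refine (integral_mono (integrable_comp_of_finite hmeas fun z => ‖m.integrandError g θ z x‖ ^ 2)
    (hgrad.add hcdf) fun ω => m.norm_integrandError_sq_le hg θ _ x).trans ?_
  simp only [Pi.add_apply]
  rw [integral_add hgrad hcdf, integral_const_mul, integral_const_mul]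
  refine (add_le_add
    (mul_le_mul_of_nonneg_left (m.integral_norm_cdfGradEst_sub_sq_le hη θ x) (by positivity))
    (mul_le_mul_of_nonneg_left (m.integral_uncappedCdfEst_sub_sq_le hη θ x)
      (by positivity))).trans_eq ?_
  ring

lemma integral_norm_riskGradEst_sub_sq_le (hg : HasBoundedLipschitzDerivOn g (Icc 0 1) C₁ C₂)
    (hr : 0 < r) (hη : IsSample η m.μ P) (θ : E) :
    ∫ ω, ‖m.riskGradEst g r θ (fun i => η i ω) - m.riskGrad g r θ‖ ^ 2 ∂P ≤
      8 * r ^ 2 * m.ratioBound ^ 2 * m.scoreBound ^ 2 * (C₁ ^ 2 + C₂ ^ 2) / Fintype.card ι := by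
  have hmeas : Measurable fun ω i => η i ω := measurable_pi_lambda _ hη.measurable
  set ε := 2 * m.ratioBound ^ 2 * m.scoreBound ^ 2 * (C₁ ^ 2 + C₂ ^ 2) / Fintype.card ι with hε
  have hswap : ∫ ω, (∫ x in (-r)..r, ‖m.integrandError g θ (fun i => η i ω) x‖ ^ 2) ∂P ≤
      2 * r * ε := by
    rw [integral_intervalIntegral_swap_of_finite hmeas fun z =>
      m.intervalIntegrable_norm_integrandError_sq g θ z _ _]
    refine (Real.le_norm_self _).trans <| (intervalIntegral.norm_integral_le_of_norm_le_const
      fun x _ => ?_).trans_eq (b := ε * |r - -r|) ?_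
    · rw [Real.norm_of_nonneg (integral_nonneg fun ω => by positivity)]
      exact m.integral_norm_integrandError_sq_le hg hη θ x
    · rw [abs_of_nonneg (by linarith)]
      ring
  calc ∫ ω, ‖m.riskGradEst g r θ (fun i => η i ω) - m.riskGrad g r θ‖ ^ 2 ∂P
      ≤ ∫ ω, 2 * r * (∫ x in (-r)..r, ‖m.integrandError g θ (fun i => η i ω) x‖ ^ 2) ∂P :=
        integral_mono
          (integrable_comp_of_finite hmeas fun z => ‖m.riskGradEst g r θ z - m.riskGrad g r θ‖ ^ 2)
          ((integrable_comp_of_finite hmeas fun z =>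
            ∫ x in (-r)..r, ‖m.integrandError g θ z x‖ ^ 2).const_mul (2 * r))
          fun ω => m.norm_riskGradEst_sub_sq_le hr g θ _
    _ ≤ 2 * r * (2 * r * ε) := by
        rw [integral_const_mul]
        exact mul_le_mul_of_nonneg_left hswap (by linarith)
    _ = _ := by rw [hε]; ring

end Estimates

end ImportanceModel

section UniformIndex

variable {Ω κ : Type*} [MeasurableSpace Ω] [MeasurableSpace κ] [MeasurableSingletonClass κ]
  {P : Measure Ω} [IsProbabilityMeasure P] {s : Finset κ} {R : Ω → κ}

lemma ae_mem_of_uniform (hs : s.Nonempty) (hR : Measurable R)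
    (hRlaw : ∀ k ∈ s, P (R ⁻¹' {k}) = (s.card : ENNReal)⁻¹) : ∀ᵐ ω ∂P, R ω ∈ s := by
  have hmem : P (R ⁻¹' s) = 1 := by
    rw [← sum_measure_preimage_singleton _ fun k _ => hR (measurableSet_singleton k),
      Finset.sum_congr rfl hRlaw, Finset.sum_const, nsmul_eq_mul,
      ENNReal.mul_inv_cancel (Nat.cast_ne_zero.2 hs.card_ne_zero) (ENNReal.natCast_ne_top _)]
  exact (prob_compl_eq_zero_iff (hR s.measurableSet)).2 hmem

lemma integrable_and_integral_uniform_index (hs : s.Nonempty) (hR : Measurable R)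
    (hRlaw : ∀ k ∈ s, P (R ⁻¹' {k}) = (s.card : ENNReal)⁻¹) {f : κ → Ω → ℝ}
    (hf : ∀ k ∈ s, Integrable (f k) P) (hRf : ∀ k ∈ s, IndepFun R (f k) P) :
    Integrable (fun ω => f (R ω) ω) P ∧
      ∫ ω, f (R ω) ω ∂P = (s.card : ℝ)⁻¹ * ∑ k ∈ s, ∫ ω, f k ω ∂P := by
  classical
  have hevent (k : κ) : MeasurableSet (R ⁻¹' {k}) := hR (measurableSet_singleton k)
  have hsplit : (fun ω => f (R ω) ω) =ᵐ[P] fun ω => ∑ k ∈ s, (R ⁻¹' {k}).indicator (f k) ω := by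
    filter_upwards [ae_mem_of_uniform hs hR hRlaw] with ω hω
    simp [indicator_apply, hω]
  have hint : ∀ k ∈ s, Integrable ((R ⁻¹' {k}).indicator (f k)) P :=
    fun k hk => (hf k hk).indicator (hevent k)
  refine ⟨(integrable_congr hsplit).2 (integrable_finsetSum _ hint), ?_⟩
  rw [integral_congr_ae hsplit, integral_finsetSum _ hint, Finset.mul_sum]
  refine Finset.sum_congr rfl fun k hk => ?_
  rw [integral_indicator (hevent k)]
  calc ∫ ω in (R ⁻¹' {k}), f k ω ∂P = P.real (R ⁻¹' {k}) * ∫ ω, f k ω ∂P :=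
        Indep.setIntegral_eq_mul hR.comap_le (f := id) (hRf k hk) (hf k hk).aemeasurable
          ⟨{k}, measurableSet_singleton k, rfl⟩ aestronglyMeasurable_id
    _ = (s.card : ℝ)⁻¹ * ∫ ω, f k ω ∂P := by
        rw [measureReal_def, hRlaw k hk, ENNReal.toReal_inv, ENNReal.toReal_natCast]

end UniformIndex

section Ascent

variable {E : Type*} [NormedAddCommGroup E]

/-- The first `N` noise variables `ζ` make `e` a bounded estimate of the gradient field `D`: given
the past, it has norm at most `Q` and mean squared error at most `V`, at every point. -/
structure IsGradientOracle {Ω T : Type*} [MeasurableSpace Ω] [MeasurableSpace T] (e : E → T → E)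
    (D : E → E) (ζ : ℕ → Ω → T) (N : ℕ) (P : Measure Ω) (Q V : ℝ) : Prop where
  measurable : ∀ k < N, Measurable (ζ k)
  indepFun_past : ∀ k < N, IndepFun (fun ω (j : Fin k) => ζ j ω) (ζ k) P
  ae_norm_le : ∀ k < N, ∀ᵐ ω ∂P, ∀ θ, ‖e θ (ζ k ω)‖ ≤ Q
  integral_norm_sub_sq_le : ∀ k < N, ∀ θ, ∫ ω, ‖e θ (ζ k ω) - D θ‖ ^ 2 ∂P ≤ V

lemma IsGradientOracle.measurable_past {Ω T : Type*} [MeasurableSpace Ω] [MeasurableSpace T]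
    {e : E → T → E} {D : E → E} {ζ : ℕ → Ω → T} {N : ℕ} {P : Measure Ω} {Q V : ℝ}
    (he : IsGradientOracle e D ζ N P Q V) {k : ℕ} (hk : k ≤ N) :
    Measurable fun ω (j : Fin k) => ζ j ω :=
  measurable_pi_lambda _ fun j => he.measurable j (j.2.trans_le hk)

variable [InnerProductSpace ℝ E]

/-- The iterates `θ_{k+1} = θ_k + α • e θ_k z_k` of stochastic gradient ascent with gradient
estimate `e`, as functions of the finite history `z_0, …, z_{k-1}` of the noise. -/
def ascentIterate {T : Type*} (e : E → T → E) (α : ℝ) (θ₀ : E) : (k : ℕ) → (Fin k → T) → E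
  | 0, _ => θ₀
  | k + 1, z =>
    let θ := ascentIterate e α θ₀ k fun j => z j.castSucc
    θ + α • e θ (z (Fin.last k))

lemma IsGradientOracle.integrable_comp_ascentIterate {Ω T : Type*} [MeasurableSpace Ω]
    [MeasurableSpace T] [Finite T] [DiscreteMeasurableSpace T] {e : E → T → E} {D : E → E}
    {ζ : ℕ → Ω → T} {N : ℕ} {P : Measure Ω} [IsFiniteMeasure P] {Q V α : ℝ} {θ₀ : E}
    (he : IsGradientOracle e D ζ N P Q V) (f : E → ℝ) {k : ℕ} (hk : k ≤ N) :
    Integrable (fun ω => f (ascentIterate e α θ₀ k fun j => ζ j ω)) P :=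
  integrable_comp_of_finite (he.measurable_past hk) fun z => f (ascentIterate e α θ₀ k z)

variable [CompleteSpace E] {ρ : E → ℝ} {D : E → E} {L α : ℝ} {θ₀ : E}

/-- The function `t ↦ ρ (θ + t v) - t ⟪D θ, v⟫ + L t² ‖v‖² / 2` is monotone on `[0, 1]`. -/
lemma le_apply_add_of_lipschitz_gradient (hD : ∀ θ, HasGradientAt ρ (D θ) θ)
    (hL : ∀ θ θ', ‖D θ - D θ'‖ ≤ L * ‖θ - θ'‖) (θ v : E) :
    ρ θ + inner ℝ (D θ) v - L / 2 * ‖v‖ ^ 2 ≤ ρ (θ + v) := by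
  let φ (t : ℝ) : ℝ := ρ (θ + t • v) - t * inner ℝ (D θ) v + L / 2 * t ^ 2 * ‖v‖ ^ 2
  have hφ (t : ℝ) : HasDerivAt φ
      (inner ℝ (D (θ + t • v)) v - 1 * inner ℝ (D θ) v + L / 2 * (2 * t) * ‖v‖ ^ 2) t := by
    have hline : HasDerivAt (fun t : ℝ => θ + t • v) v t := by
      simpa only [id_eq, one_smul] using ((hasDerivAt_id t).smul_const v).const_add θ
    have hsq : HasDerivAt (fun t : ℝ => t ^ 2) (2 * t) t := by simpa using hasDerivAt_pow 2 t
    exact (((hD _).hasFDerivAt.comp_hasDerivAt t hline).sub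
      ((hasDerivAt_id t).mul_const _)).add ((hsq.const_mul (L / 2)).mul_const _)
  have hmono : MonotoneOn φ (Icc 0 1) := by
    refine monotoneOn_of_hasDerivWithinAt_nonneg (convex_Icc 0 1)
      (fun t _ => (hφ t).continuousAt.continuousWithinAt)
      (fun t _ => (hφ t).hasDerivWithinAt) fun t ht => ?_
    rw [interior_Icc] at ht
    have hinner : -(L * (t * ‖v‖) * ‖v‖) ≤ inner ℝ (D (θ + t • v) - D θ) v := by
      refine (neg_le_neg ?_).trans (abs_le.1 (abs_real_inner_le_norm _ _)).1
      refine mul_le_mul_of_nonneg_right ((hL _ _).trans_eq ?_) (norm_nonneg v)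
      rw [add_sub_cancel_left, norm_smul, Real.norm_of_nonneg ht.1.le]
    rw [inner_sub_left] at hinner
    linarith
  have h : φ 0 ≤ φ 1 := hmono (by simp) (by simp) zero_le_one
  simp only [φ, zero_smul, one_smul, add_zero] at h
  linarith

lemma half_norm_sq_le_of_ascent (hD : ∀ θ, HasGradientAt ρ (D θ) θ)
    (hL : ∀ θ θ', ‖D θ - D θ'‖ ≤ L * ‖θ - θ'‖) (hα : 0 ≤ α) (θ u : E) :
    α / 2 * ‖D θ‖ ^ 2 ≤
      ρ (θ + α • u) - ρ θ + α / 2 * ‖u - D θ‖ ^ 2 + L / 2 * α ^ 2 * ‖u‖ ^ 2 := by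
  have hascent := le_apply_add_of_lipschitz_gradient hD hL θ (α • u)
  rw [norm_smul, mul_pow, Real.norm_eq_abs, sq_abs, real_inner_smul_right] at hascent
  have hu : 0 ≤ α / 2 * ‖u‖ ^ 2 := by positivity
  rw [norm_sub_sq_real, real_inner_comm]
  linarith

variable {Ω T : Type*} [MeasurableSpace Ω] {P : Measure Ω} [IsProbabilityMeasure P] [Finite T]
  [MeasurableSpace T] [DiscreteMeasurableSpace T] {e : E → T → E} {Q V : ℝ}

lemma half_integral_norm_sq_le_of_ascent {S : Type*} [Finite S] [MeasurableSpace S]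
    [DiscreteMeasurableSpace S] (hD : ∀ θ, HasGradientAt ρ (D θ) θ) (hL₀ : 0 ≤ L)
    (hL : ∀ θ θ', ‖D θ - D θ'‖ ≤ L * ‖θ - θ'‖) (hα : 0 ≤ α) {X : Ω → S} {Z : Ω → T}
    (hX : Measurable X) (hZ : Measurable Z) (hXZ : IndepFun X Z P)
    (hQ : ∀ᵐ ω ∂P, ∀ θ, ‖e θ (Z ω)‖ ≤ Q) (hV : ∀ θ, ∫ ω, ‖e θ (Z ω) - D θ‖ ^ 2 ∂P ≤ V)
    (Θ : S → E) :
    α / 2 * ∫ ω, ‖D (Θ (X ω))‖ ^ 2 ∂P ≤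
      ∫ ω, ρ (Θ (X ω) + α • e (Θ (X ω)) (Z ω)) ∂P - ∫ ω, ρ (Θ (X ω)) ∂P +
        (α / 2 * V + L / 2 * α ^ 2 * Q ^ 2) := by
  have hint (f : S × T → ℝ) : Integrable (fun ω => f (X ω, Z ω)) P :=
    integrable_comp_of_finite (hX.prodMk hZ) f
  have herr : ∫ ω, ‖e (Θ (X ω)) (Z ω) - D (Θ (X ω))‖ ^ 2 ∂P ≤ V :=
    integral_le_of_indepFun hX hZ hXZ (f := fun x t => ‖e (Θ x) t - D (Θ x)‖ ^ 2) fun x => hV _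
  have hnext : Integrable (fun ω => ρ (Θ (X ω) + α • e (Θ (X ω)) (Z ω))) P :=
    hint fun z => ρ (Θ z.1 + α • e (Θ z.1) z.2)
  have hcurrent : Integrable (fun ω => ρ (Θ (X ω))) P := hint fun z => ρ (Θ z.1)
  have hsq : Integrable (fun ω => α / 2 * ‖e (Θ (X ω)) (Z ω) - D (Θ (X ω))‖ ^ 2) P :=
    hint fun z => α / 2 * ‖e (Θ z.1) z.2 - D (Θ z.1)‖ ^ 2
  calc α / 2 * ∫ ω, ‖D (Θ (X ω))‖ ^ 2 ∂P
      ≤ ∫ ω, ρ (Θ (X ω) + α • e (Θ (X ω)) (Z ω)) - ρ (Θ (X ω)) +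
          α / 2 * ‖e (Θ (X ω)) (Z ω) - D (Θ (X ω))‖ ^ 2 + L / 2 * α ^ 2 * Q ^ 2 ∂P := by
        rw [← integral_const_mul]
        refine integral_mono_ae (hint fun z => α / 2 * ‖D (Θ z.1)‖ ^ 2)
          (((hnext.sub hcurrent).add hsq).add (integrable_const _)) ?_
        filter_upwards [hQ] with ω hω
        have := hω (Θ (X ω))
        refine (half_norm_sq_le_of_ascent hD hL hα (Θ (X ω)) (e (Θ (X ω)) (Z ω))).trans ?_
        gcongr
    _ ≤ _ := by
        rw [integral_add (by exact (hnext.sub hcurrent).add hsq) (integrable_const _),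
          integral_add (by exact hnext.sub hcurrent) hsq,
          integral_sub hnext hcurrent, integral_const_mul, integral_const, probReal_univ, one_smul,
          add_assoc]
        gcongr

variable {ζ : ℕ → Ω → T} {N : ℕ}

namespace IsGradientOracle

variable (he : IsGradientOracle e D ζ N P Q V)
include he

lemma sum_integral_norm_sq_le (hD : ∀ θ, HasGradientAt ρ (D θ) θ) (hL₀ : 0 ≤ L)
    (hL : ∀ θ θ', ‖D θ - D θ'‖ ≤ L * ‖θ - θ'‖) (hα : 0 < α) {ρs : ℝ} (hρs : ∀ θ, ρ θ ≤ ρs) :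
    ∑ k ∈ Finset.range N, ∫ ω, ‖D (ascentIterate e α θ₀ k fun j => ζ j ω)‖ ^ 2 ∂P ≤
      2 * (ρs - ρ θ₀) / α + N * (V + L * α * Q ^ 2) := by
  let Φ (k : ℕ) : ℝ := ∫ ω, ρ (ascentIterate e α θ₀ k fun j => ζ j ω) ∂P
  have hstep : ∀ k ∈ Finset.range N,
      α / 2 * ∫ ω, ‖D (ascentIterate e α θ₀ k fun j => ζ j ω)‖ ^ 2 ∂P ≤
        Φ (k + 1) - Φ k + (α / 2 * V + L / 2 * α ^ 2 * Q ^ 2) := fun k hk =>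
    have hk := Finset.mem_range.1 hk
    half_integral_norm_sq_le_of_ascent hD hL₀ hL hα.le (he.measurable_past hk.le)
      (he.measurable k hk) (he.indepFun_past k hk) (he.ae_norm_le k hk)
      (he.integral_norm_sub_sq_le k hk) (ascentIterate e α θ₀ k)
  have hsum := Finset.sum_le_sum hstep
  rw [← Finset.mul_sum, Finset.sum_add_distrib, Finset.sum_range_sub Φ, Finset.sum_const,
    Finset.card_range, nsmul_eq_mul] at hsum
  have hlast : Φ N ≤ ρs :=
    (integral_mono (he.integrable_comp_ascentIterate ρ le_rfl) (integrable_const ρs)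
      fun ω => hρs _).trans_eq (by simp)
  have hfirst : Φ 0 = ρ θ₀ := by simp [Φ, ascentIterate]
  rw [← mul_le_mul_iff_of_pos_left (half_pos hα)]
  calc _ ≤ ρs - ρ θ₀ + N * (α / 2 * V + L / 2 * α ^ 2 * Q ^ 2) := by linarith
    _ = _ := by field_simp

/-- The last iterate, which the telescoping sum over `{0, …, N - 1}` misses, contributes the term
`K ^ 2 / N`. -/
theorem integral_norm_sq_uniform_index_le (hD : ∀ θ, HasGradientAt ρ (D θ) θ) (hL₀ : 0 ≤ L)
    (hL : ∀ θ θ', ‖D θ - D θ'‖ ≤ L * ‖θ - θ'‖) (hα : 0 < α) {ρs K : ℝ} (hρs : ∀ θ, ρ θ ≤ ρs)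
    (hK : ∀ θ, ‖D θ‖ ≤ K) (hN : 0 < N) {R : Ω → ℕ} (hR : Measurable R)
    (hRlaw : ∀ k ∈ Finset.Icc 1 N, P {ω | R ω = k} = (N : ENNReal)⁻¹)
    (hRζ : ∀ k ≤ N, IndepFun R (fun ω (j : Fin k) => ζ j ω) P) :
    Integrable (fun ω => ‖D (ascentIterate e α θ₀ (R ω) fun j => ζ j ω)‖ ^ 2) P ∧
      ∫ ω, ‖D (ascentIterate e α θ₀ (R ω) fun j => ζ j ω)‖ ^ 2 ∂P ≤
        2 * (ρs - ρ θ₀) / (N * α) + V + L * α * Q ^ 2 + K ^ 2 / N := by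
  have : (0 : ℝ) < N := Nat.cast_pos.2 hN
  let f (k : ℕ) (ω : Ω) : ℝ := ‖D (ascentIterate e α θ₀ k fun j => ζ j ω)‖ ^ 2
  have hf (k : ℕ) (hk : k ≤ N) : Integrable (f k) P :=
    he.integrable_comp_ascentIterate (fun θ => ‖D θ‖ ^ 2) hk
  have hRf (k : ℕ) (hk : k ≤ N) : IndepFun R (f k) P :=
    (hRζ k hk).comp measurable_id (ψ := fun z => ‖D (ascentIterate e α θ₀ k z)‖ ^ 2) .of_discrete
  have hcard : (Finset.Icc 1 N).card = N := by simp
  obtain ⟨hint, heq⟩ := integrable_and_integral_uniform_index (Finset.nonempty_Icc.2 hN) hR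
    (by rwa [hcard]) (fun k hk => hf k (Finset.mem_Icc.1 hk).2)
    (fun k hk => hRf k (Finset.mem_Icc.1 hk).2)
  refine ⟨hint, heq.trans_le ?_⟩
  have hlast : ∫ ω, f N ω ∂P ≤ K ^ 2 :=
    (integral_mono (hf N le_rfl) (integrable_const (K ^ 2)) fun ω =>
      pow_le_pow_left₀ (norm_nonneg _) (hK _) 2).trans_eq (by simp)
  have hshift : ∑ k ∈ Finset.Icc 1 N, ∫ ω, f k ω ∂P ≤
      ∑ k ∈ Finset.range N, ∫ ω, f k ω ∂P + K ^ 2 := by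
    have hfirst : 0 ≤ ∫ ω, f 0 ω ∂P := integral_nonneg fun ω => by positivity
    have htotal := Finset.sum_range_succ (fun k => ∫ ω, f k ω ∂P) N
    rw [Finset.range_eq_Ico, Finset.sum_eq_sum_Ico_succ_bot N.succ_pos] at htotal
    change _ + ∑ k ∈ Finset.Icc 1 N, ∫ ω, f k ω ∂P = _ at htotal
    linarith
  have hsum := he.sum_integral_norm_sq_le (θ₀ := θ₀) hD hL₀ hL hα hρs
  calc ((Finset.Icc 1 N).card : ℝ)⁻¹ * ∑ k ∈ Finset.Icc 1 N, ∫ ω, f k ω ∂P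
      ≤ (N : ℝ)⁻¹ * (2 * (ρs - ρ θ₀) / α + N * (V + L * α * Q ^ 2) + K ^ 2) := by
        rw [hcard]
        gcongr
        linarith
    _ = _ := by field_simp; ring

end IsGradientOracle

end Ascent

namespace EpisodicMDP

variable {S A : Type*} (M : EpisodicMDP S A)

/-! ### Truncated episodes -/

open Classical in
/-- Replaces the action taken in the terminal state by the fixed action `a₀`. A policy `π_θ` and the
behavior policy may act differently in the terminal state, which would spoil the change of measure
by `isRatio`, a product over the times before termination. -/
def collapse (a₀ : A) (x : S × A) : S × A := if x.1 = M.terminal then (M.terminal, a₀) else x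

lemma fst_collapse (a₀ : A) (x : S × A) : (M.collapse a₀ x).1 = x.1 := by
  unfold collapse
  split_ifs with hx
  exacts [hx.symm, rfl]

lemma collapse_of_fst_ne (a₀ : A) {x : S × A} (hx : x.1 ≠ M.terminal) : M.collapse a₀ x = x :=
  if_neg hx

/-- The first `K + 1` steps of a trajectory, with collapsed terminal actions. -/
def truncate (a₀ : A) (K : ℕ) (ω : ℕ → S × A) : Fin (K + 1) → S × A :=
  fun i => M.collapse a₀ (ω i)

/-- The trajectory which follows a finite path and then stays in its last position. -/
def extendPath {X : Type*} {K : ℕ} (h : Fin (K + 1) → X) : ℕ → X :=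
  fun t => h ⟨min t K, by omega⟩

/-- The terminal state is visited not later than time `K`. -/
def TerminatesBy (K : ℕ) (ω : ℕ → S × A) : Prop := ∃ t ≤ K, (ω t).1 = M.terminal

variable {M}

lemma isRatio_nonneg (π b : S → PMF A) (ω : ℕ → S × A) : 0 ≤ M.isRatio π b ω :=
  Finset.prod_nonneg fun _ _ => by positivity

lemma Terminates.fst_length {ω : ℕ → S × A} (h : M.Terminates ω) :
    (ω (M.length ω)).1 = M.terminal := Nat.sInf_mem h

lemma fst_ne_terminal_of_lt_length {ω : ℕ → S × A} {t : ℕ} (ht : t < M.length ω) :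
    (ω t).1 ≠ M.terminal := fun h => Nat.notMem_of_lt_sInf ht h

lemma Terminates.terminatesBy_floor {ω : ℕ → S × A} {c : ℝ} (h : M.Terminates ω)
    (hc : (M.length ω : ℝ) ≤ c) : M.TerminatesBy ⌊c⌋₊ ω :=
  ⟨M.length ω, Nat.le_floor hc, h.fst_length⟩

namespace TerminatesBy

variable {K : ℕ} {ω ω' : ℕ → S × A}

lemma length_le (h : M.TerminatesBy K ω) : M.length ω ≤ K :=
  let ⟨_, htK, ht⟩ := h
  (Nat.sInf_le ht).trans htK

lemma fst_length (h : M.TerminatesBy K ω) : (ω (M.length ω)).1 = M.terminal :=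
  let ⟨t, _, ht⟩ := h
  Terminates.fst_length ⟨t, ht⟩

lemma congr (h : M.TerminatesBy K ω) (hω : ∀ t ≤ K, (ω' t).1 = (ω t).1) : M.TerminatesBy K ω' :=
  let ⟨t, htK, ht⟩ := h
  ⟨t, htK, (hω t htK).trans ht⟩

lemma length_congr (h : M.TerminatesBy K ω) (hω : ∀ t ≤ K, (ω' t).1 = (ω t).1) :
    M.length ω' = M.length ω := by
  have h' := h.congr hω
  exact le_antisymm (Nat.sInf_le ((hω _ h.length_le).trans h.fst_length))
    (Nat.sInf_le ((hω _ h'.length_le).symm.trans h'.fst_length))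

end TerminatesBy

section ExtendTruncate

variable (a₀ : A) {K : ℕ} {ω : ℕ → S × A}

lemma fst_extendPath_truncate {t : ℕ} (ht : t ≤ K) :
    (extendPath (M.truncate a₀ K ω) t).1 = (ω t).1 := by
  simp only [extendPath, truncate, fst_collapse, min_eq_left ht]

lemma terminatesBy_extendPath_truncate :
    M.TerminatesBy K (extendPath (M.truncate a₀ K ω)) ↔ M.TerminatesBy K ω :=
  ⟨fun h => h.congr fun _ ht => (fst_extendPath_truncate a₀ ht).symm,
    fun h => h.congr fun _ ht => fst_extendPath_truncate a₀ ht⟩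

variable (h : M.TerminatesBy K ω)
include h

lemma length_extendPath_truncate : M.length (extendPath (M.truncate a₀ K ω)) = M.length ω :=
  h.length_congr fun _ ht => fst_extendPath_truncate a₀ ht

lemma extendPath_truncate_of_lt_length {t : ℕ} (ht : t < M.length ω) :
    extendPath (M.truncate a₀ K ω) t = ω t := by
  simp only [extendPath, truncate, min_eq_left (ht.le.trans h.length_le),
    M.collapse_of_fst_ne a₀ (fst_ne_terminal_of_lt_length ht)]

lemma cumReward_extendPath_truncate :
    M.cumReward (extendPath (M.truncate a₀ K ω)) = M.cumReward ω := by
  unfold cumReward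
  rw [length_extendPath_truncate a₀ h]
  refine Finset.sum_congr rfl fun t ht => ?_
  rw [Finset.mem_range] at ht
  rw [extendPath_truncate_of_lt_length a₀ h ht,
    fst_extendPath_truncate a₀ (Nat.succ_le_of_lt (ht.trans_le h.length_le))]

lemma isRatio_extendPath_truncate (π b : S → PMF A) :
    M.isRatio π b (extendPath (M.truncate a₀ K ω)) = M.isRatio π b ω := by
  unfold isRatio
  rw [length_extendPath_truncate a₀ h]
  refine Finset.prod_congr rfl fun t ht => ?_
  rw [extendPath_truncate_of_lt_length a₀ h (Finset.mem_range.1 ht)]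

lemma score_extendPath_truncate {d : ℕ} (π : EuclideanSpace ℝ (Fin d) → S → PMF A)
    (θ : EuclideanSpace ℝ (Fin d)) :
    M.score π θ (extendPath (M.truncate a₀ K ω)) = M.score π θ ω := by
  unfold score
  rw [length_extendPath_truncate a₀ h]
  refine Finset.sum_congr rfl fun t ht => ?_
  rw [extendPath_truncate_of_lt_length a₀ h (Finset.mem_range.1 ht)]

end ExtendTruncate

variable (M)

/-! ### Change of measure -/

/-- The distribution of the next state-action pair under the policy `π`. -/
def stepPMF (π : S → PMF A) (x : S × A) : PMF (S × A) :=
  (M.p x.1 x.2).bind fun s' => (π s').map (Prod.mk s')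

lemma stepPMF_collapse (π : S → PMF A) (a₀ : A) (x : S × A) :
    M.stepPMF π (M.collapse a₀ x) = M.stepPMF π x := by
  by_cases hx : x.1 = M.terminal
  · rw [stepPMF, stepPMF, collapse, if_pos hx, hx, M.absorbing, M.absorbing]
  · rw [M.collapse_of_fst_ne a₀ hx]

open Classical in
/-- The one-step likelihood ratio, which is `1` in the terminal state because its actions are
collapsed. -/
def stepRatio (π b : S → PMF A) (y : S × A) : ENNReal :=
  if y.1 = M.terminal then 1 else π y.1 y.2 / b y.1 y.2

variable [MeasurableSpace A] [DiscreteMeasurableSpace A]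

lemma toMeasure_collapse_eq_mul_stepRatio (π : S → PMF A) {b : S → PMF A} (hb : ∀ s a, b s a ≠ 0)
    (a₀ : A) (s : S) (y : S × A) :
    (π s).toMeasure {a | M.collapse a₀ (s, a) = y} =
      (b s).toMeasure {a | M.collapse a₀ (s, a) = y} * M.stepRatio π b y := by
  by_cases hs : s = M.terminal
  · by_cases hy : (M.terminal, a₀) = y
    · simp [collapse, hs, ← hy, stepRatio]
    · simp [collapse, hs, hy]
  · have hcollapse (a : A) : M.collapse a₀ (s, a) = (s, a) := M.collapse_of_fst_ne a₀ hs
    simp_rw [hcollapse]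
    by_cases hy : s = y.1
    · have hfiber : {a | (s, a) = y} = {y.2} := by
        ext a
        simp [Prod.ext_iff, hy]
      rw [hfiber, PMF.toMeasure_apply_singleton _ _ .of_discrete,
        PMF.toMeasure_apply_singleton _ _ .of_discrete, stepRatio, if_neg (hy ▸ hs), hy,
        ENNReal.mul_div_cancel (hb _ _) (PMF.apply_ne_top _ _)]
    · have hfiber : {a | (s, a) = y} = ∅ := by
        ext a
        simp [Prod.ext_iff, hy]
      simp [hfiber]

variable [MeasurableSpace S] [DiscreteMeasurableSpace S]

lemma toMeasure_stepPMF [Countable S] [Countable A] (π : S → PMF A) (x : S × A) (C : Set (S × A)) :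
    (M.stepPMF π x).toMeasure C =
      ∑' s', M.p x.1 x.2 s' * (π s').toMeasure {a | (s', a) ∈ C} := by
  rw [stepPMF, PMF.toMeasure_bind_apply _ _ _ .of_discrete]
  refine tsum_congr fun s' => ?_
  rw [PMF.toMeasure_map_apply _ _ _ (by fun_prop) .of_discrete]
  rfl

lemma measurable_truncate [Countable S] [Countable A] (a₀ : A) (K : ℕ) :
    Measurable (M.truncate a₀ K) :=
  measurable_pi_lambda _ fun _ =>
    (Measurable.of_discrete (f := M.collapse a₀)).comp (measurable_pi_apply _)

variable [Fintype S] [Fintype A]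

instance isProbabilityMeasure_law (π : S → PMF A) (s : S) : IsProbabilityMeasure (M.law π s) := by
  unfold law
  infer_instance

/-- The probability that the first `n + 1` steps of a trajectory agree with `h`, up to the actions
taken in the terminal state. -/
def pathProb (π : S → PMF A) (s : S) (a₀ : A) (n : ℕ) (h : ℕ → S × A) : ENNReal :=
  M.law π s {ω | ∀ t ≤ n, M.collapse a₀ (ω t) = h t}

lemma map_eval_zero_law (π : S → PMF A) (s : S) :
    (M.law π s).map (fun ω => ω 0) = ((π s).map (Prod.mk s)).toMeasure := by
  have heval : (fun ω : ℕ → S × A => ω 0) =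
      (fun u : (i : Finset.Iic 0) → S × A => u ⟨0, by simp⟩) ∘ Preorder.frestrictLe 0 := rfl
  rw [heval, ← Measure.map_map (by fun_prop) (by fun_prop), law, Kernel.trajMeasure,
    Measure.map_comp _ _ (by fun_prop), Kernel.traj_map_frestrictLe, Kernel.partialTraj_self,
    Measure.id_comp, Measure.map_map (by fun_prop) (by fun_prop)]
  exact Measure.map_id

lemma pathProb_zero (π : S → PMF A) (s : S) (a₀ : A) (h : ℕ → S × A) :
    M.pathProb π s a₀ 0 h = (π s).toMeasure {a | M.collapse a₀ (s, a) = h 0} := by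
  have hevent : {ω : ℕ → S × A | ∀ t ≤ 0, M.collapse a₀ (ω t) = h t} =
      (fun ω => ω 0) ⁻¹' {x | M.collapse a₀ x = h 0} := by
    ext ω
    simp
  rw [pathProb, hevent, ← Measure.map_apply (by fun_prop) .of_discrete, map_eval_zero_law,
    PMF.toMeasure_map_apply _ _ _ (by fun_prop) .of_discrete]
  rfl

lemma pathProb_succ (π : S → PMF A) (s : S) (a₀ : A) (n : ℕ) (h : ℕ → S × A) :
    M.pathProb π s a₀ (n + 1) h =
      M.pathProb π s a₀ n h * (M.stepPMF π (h n)).toMeasure {z | M.collapse a₀ z = h (n + 1)} := by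
  set past : Set ((_ : Finset.Iic n) → S × A) := {u | ∀ i, M.collapse a₀ (u i) = h i} with hpast
  set next : Set (S × A) := {z | M.collapse a₀ z = h (n + 1)} with hnext
  have hpast_meas : MeasurableSet past := .of_discrete
  have hevent_past : {ω : ℕ → S × A | ∀ t ≤ n, M.collapse a₀ (ω t) = h t} =
      Preorder.frestrictLe (π := fun _ => S × A) n ⁻¹' past := by
    ext ω
    simp [hpast]
  have hevent : {ω : ℕ → S × A | ∀ t ≤ n + 1, M.collapse a₀ (ω t) = h t} =
      (fun x => (Preorder.frestrictLe n x, x (n + 1))) ⁻¹' (past ×ˢ next) := by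
    ext ω
    simp [hpast, hnext, Nat.le_succ_iff, or_imp, forall_and]
  rw [pathProb, pathProb, hevent, hevent_past,
    ← Measure.map_apply (by fun_prop) (hpast_meas.prod .of_discrete), law,
    ← Kernel.map_frestrictLe_trajMeasure_compProd_eq_map_trajMeasure (X := fun _ => S × A),
    Measure.compProd_apply_prod hpast_meas .of_discrete,
    ← Measure.map_apply (by fun_prop) hpast_meas, mul_comm, ← setLIntegral_const]
  refine setLIntegral_congr_fun hpast_meas fun u hu => ?_
  have hlast := hu ⟨n, Finset.mem_Iic.2 le_rfl⟩
  simp only [← hlast, stepPMF_collapse]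
  rfl

lemma pathProb_eq_mul_prod_stepRatio (π : S → PMF A) {b : S → PMF A} (hb : ∀ s a, b s a ≠ 0)
    (s : S) (a₀ : A) (n : ℕ) (h : ℕ → S × A) :
    M.pathProb π s a₀ n h =
      M.pathProb b s a₀ n h * ∏ t ∈ Finset.range (n + 1), M.stepRatio π b (h t) := by
  induction n with
  | zero =>
    rw [pathProb_zero, pathProb_zero, zero_add, Finset.prod_range_one]
    exact M.toMeasure_collapse_eq_mul_stepRatio π hb a₀ s _
  | succ n ih =>
    have hstep : (M.stepPMF π (h n)).toMeasure {z | M.collapse a₀ z = h (n + 1)} =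
        (M.stepPMF b (h n)).toMeasure {z | M.collapse a₀ z = h (n + 1)} *
          M.stepRatio π b (h (n + 1)) := by
      rw [toMeasure_stepPMF, toMeasure_stepPMF, ← ENNReal.tsum_mul_right]
      refine tsum_congr fun s' => ?_
      rw [mul_assoc]
      exact congrArg _ (M.toMeasure_collapse_eq_mul_stepRatio π hb a₀ s' _)
    rw [pathProb_succ, pathProb_succ, ih, hstep, Finset.prod_range_succ _ (n + 1)]
    ring

variable {M}

lemma fst_succ_eq_terminal_of_pathProb_ne_zero {π : S → PMF A} {s : S} {a₀ : A} {n : ℕ}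
    {h : ℕ → S × A} (hn : M.pathProb π s a₀ (n + 1) h ≠ 0) (hterminal : (h n).1 = M.terminal) :
    (h (n + 1)).1 = M.terminal := by
  by_contra hne
  rw [pathProb_succ] at hn
  refine right_ne_zero_of_mul hn ?_
  rw [toMeasure_stepPMF, hterminal, M.absorbing, ENNReal.tsum_eq_zero]
  intro s'
  by_cases hs : s' = M.terminal
  · have hempty : {a | (s', a) ∈ {z | M.collapse a₀ z = h (n + 1)}} = ∅ := by
      refine Set.eq_empty_of_forall_notMem fun a ha => hne ?_
      rw [← show M.collapse a₀ (s', a) = h (n + 1) from ha, fst_collapse, hs]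
    rw [hempty, measure_empty, mul_zero]
  · simp [PMF.pure_apply, hs]

lemma pathProb_ne_zero_of_le {π : S → PMF A} {s : S} {a₀ : A} {n k : ℕ} {h : ℕ → S × A}
    (hn : M.pathProb π s a₀ n h ≠ 0) (hkn : k ≤ n) : M.pathProb π s a₀ k h ≠ 0 :=
  fun hk => hn <| measure_mono_null
    (Set.ofPred_subset_ofPred.2 fun _ hω t ht => hω t (ht.trans hkn)) hk

lemma fst_eq_terminal_of_pathProb_ne_zero {π : S → PMF A} {s : S} {a₀ : A} {n : ℕ}
    {h : ℕ → S × A} (hn : M.pathProb π s a₀ n h ≠ 0) {t u : ℕ} (htu : t ≤ u) (hun : u ≤ n)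
    (hterminal : (h t).1 = M.terminal) : (h u).1 = M.terminal := by
  induction u, htu using Nat.le_induction with
  | base => exact hterminal
  | succ u _ ih =>
    exact fst_succ_eq_terminal_of_pathProb_ne_zero (pathProb_ne_zero_of_le hn hun) (ih (by omega))

lemma prod_stepRatio_eq_ofReal_isRatio (π : S → PMF A) {b : S → PMF A} (hb : ∀ s a, b s a ≠ 0)
    {s : S} {a₀ : A} {n : ℕ} {h : ℕ → S × A} (hn : M.pathProb b s a₀ n h ≠ 0)
    (hterm : M.TerminatesBy n h) :
    ∏ t ∈ Finset.range (n + 1), M.stepRatio π b (h t) = ENNReal.ofReal (M.isRatio π b h) := by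
  rw [isRatio, ENNReal.ofReal_prod_of_nonneg fun _ _ => by positivity, eq_comm]
  have hlength := hterm.length_le
  refine (Finset.prod_congr rfl fun t ht => ?_).trans
    (Finset.prod_subset (Finset.range_subset_range.2 (by omega)) fun t htn htlen => ?_)
  · rw [stepRatio, if_neg (fst_ne_terminal_of_lt_length (Finset.mem_range.1 ht)),
      ENNReal.ofReal_div_of_pos (ENNReal.toReal_pos (hb _ _) (PMF.apply_ne_top _ _)),
      ENNReal.ofReal_toReal (PMF.apply_ne_top _ _), ENNReal.ofReal_toReal (PMF.apply_ne_top _ _)]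
  · rw [Finset.mem_range] at htn htlen
    exact if_pos (fst_eq_terminal_of_pathProb_ne_zero hn (not_lt.1 htlen) (by omega)
      hterm.fst_length)

variable (M)

/-- The law of the first `K + 1` steps of an episode of the policy `π`, with collapsed terminal
actions. -/
def pathLaw (π : S → PMF A) (a₀ : A) (K : ℕ) : Measure (Fin (K + 1) → S × A) :=
  (M.law π M.start).map (M.truncate a₀ K)

instance isProbabilityMeasure_pathLaw (π : S → PMF A) (a₀ : A) (K : ℕ) :
    IsProbabilityMeasure (M.pathLaw π a₀ K) :=
  Measure.isProbabilityMeasure_map (M.measurable_truncate a₀ K).aemeasurable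

lemma ae_pathLaw_iff {π : S → PMF A} {a₀ : A} {K : ℕ} {p : (Fin (K + 1) → S × A) → Prop} :
    (∀ᵐ h ∂M.pathLaw π a₀ K, p h) ↔ ∀ᵐ ω ∂M.law π M.start, p (M.truncate a₀ K ω) :=
  ae_map_iff (M.measurable_truncate a₀ K).aemeasurable .of_discrete

lemma ae_pathLaw_terminatesBy_iff {π : S → PMF A} (a₀ : A) {K : ℕ} :
    (∀ᵐ h ∂M.pathLaw π a₀ K, M.TerminatesBy K (extendPath h)) ↔
      ∀ᵐ ω ∂M.law π M.start, M.TerminatesBy K ω := by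
  simp only [ae_pathLaw_iff, terminatesBy_extendPath_truncate]

lemma pathLaw_singleton (π : S → PMF A) (a₀ : A) (K : ℕ) (h : Fin (K + 1) → S × A) :
    M.pathLaw π a₀ K {h} = M.pathProb π M.start a₀ K (extendPath h) := by
  rw [pathLaw, Measure.map_apply (M.measurable_truncate a₀ K) .of_discrete]
  refine congrArg _ (Set.ext fun ω => ?_)
  simp only [Set.mem_preimage, Set.mem_singleton_iff, Set.mem_ofPred_eq, funext_iff, truncate,
    Fin.forall_iff, Nat.lt_succ_iff]
  refine forall₂_congr fun t ht => ?_
  simp only [extendPath, min_eq_left ht]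

variable {M}

lemma pathLaw_eq_withDensity (π : S → PMF A) {b : S → PMF A} (hb : ∀ s a, b s a ≠ 0) (a₀ : A)
    {K : ℕ} (hK : ∀ᵐ ω ∂M.law b M.start, M.TerminatesBy K ω) :
    M.pathLaw π a₀ K = (M.pathLaw b a₀ K).withDensity
      fun h => ENNReal.ofReal (M.isRatio π b (extendPath h)) := by
  have hterm := (M.ae_pathLaw_terminatesBy_iff a₀).2 hK
  refine Measure.ext_iff_singleton.2 fun h => ?_
  rw [withDensity_apply _ .of_discrete, lintegral_singleton, mul_comm]
  by_cases hh : M.pathLaw b a₀ K {h} = 0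
  · rw [hh, zero_mul]
    rw [pathLaw_singleton] at hh
    rw [pathLaw_singleton, M.pathProb_eq_mul_prod_stepRatio π hb, hh, zero_mul]
  · have hterm_h := ae_iff_of_countable.1 hterm h hh
    rw [pathLaw_singleton] at hh
    rw [pathLaw_singleton, pathLaw_singleton, M.pathProb_eq_mul_prod_stepRatio π hb,
      prod_stepRatio_eq_ofReal_isRatio π hb hh hterm_h]

lemma setIntegral_isRatio_pathLaw (π : S → PMF A) {b : S → PMF A} (hb : ∀ s a, b s a ≠ 0) (a₀ : A)
    {K : ℕ} (hK : ∀ᵐ ω ∂M.law b M.start, M.TerminatesBy K ω) (s : Set (Fin (K + 1) → S × A)) :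
    ∫ h in s, M.isRatio π b (extendPath h) ∂M.pathLaw b a₀ K = (M.pathLaw π a₀ K).real s := by
  rw [integral_eq_lintegral_of_nonneg_ae (ae_of_all _ fun h => isRatio_nonneg π b _) .of_discrete,
    ← withDensity_apply _ .of_discrete, ← pathLaw_eq_withDensity π hb a₀ hK, measureReal_def]

lemma ae_terminatesBy (π : S → PMF A) {b : S → PMF A} (hb : ∀ s a, b s a ≠ 0) {K : ℕ}
    (hK : ∀ᵐ ω ∂M.law b M.start, M.TerminatesBy K ω) :
    ∀ᵐ ω ∂M.law π M.start, M.TerminatesBy K ω := by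
  obtain ⟨a₀⟩ : Nonempty A := (b M.start).support_nonempty.to_type
  have hac : M.pathLaw π a₀ K ≪ M.pathLaw b a₀ K := by
    rw [pathLaw_eq_withDensity π hb a₀ hK]
    exact withDensity_absolutelyContinuous _ _
  exact (M.ae_pathLaw_terminatesBy_iff a₀).1
    (hac.ae_le ((M.ae_pathLaw_terminatesBy_iff a₀).2 hK))

lemma rewardCDF_eq_setIntegral_isRatio (π : S → PMF A) {b : S → PMF A} (hb : ∀ s a, b s a ≠ 0)
    (a₀ : A) {K : ℕ} (hK : ∀ᵐ ω ∂M.law b M.start, M.TerminatesBy K ω) (x : ℝ) :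
    M.rewardCDF π x = ∫ h in {h | M.cumReward (extendPath h) ≤ x},
      M.isRatio π b (extendPath h) ∂M.pathLaw b a₀ K := by
  rw [setIntegral_isRatio_pathLaw π hb a₀ hK, pathLaw,
    map_measureReal_apply (M.measurable_truncate a₀ K) .of_discrete]
  refine measureReal_congr ?_
  filter_upwards [ae_terminatesBy π hb hK] with ω hω
  refine propext ?_
  change M.cumReward ω ≤ x ↔ M.cumReward (extendPath (M.truncate a₀ K ω)) ≤ x
  rw [cumReward_extendPath_truncate a₀ hω]

end EpisodicMDP

/-! ### The off-policy algorithm -/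

namespace EpisodicMDP

variable {S A : Type*} {M : EpisodicMDP S A} {d : ℕ}
  {π : EuclideanSpace ℝ (Fin d) → S → PMF A}

lemma rewardBound_pos : 0 < M.rewardBound :=
  div_pos M.rmax_pos (sub_pos.2 M.γ_lt_one)

lemma hasGradientAt_policy (hπ : ∀ θ s a, π θ s a ≠ 0)
    (hπ' : ∀ s a, Differentiable ℝ (logPolicy π s a)) (s : S) (a : A)
    (θ : EuclideanSpace ℝ (Fin d)) :
    HasGradientAt (fun θ => (π θ s a).toReal)
      ((π θ s a).toReal • gradient (logPolicy π s a) θ) θ := by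
  have hexp (θ) : (π θ s a).toReal = Real.exp (logPolicy π s a θ) := by
    rw [logPolicy, Real.exp_log (ENNReal.toReal_pos (hπ θ s a) (PMF.apply_ne_top _ _))]
  rw [hasGradientAt_iff_hasFDerivAt, map_smul]
  simp only [hexp]
  exact (hπ' s a θ).hasGradientAt.hasFDerivAt.exp

lemma hasGradientAt_isRatio (b : S → PMF A) (hπ : ∀ θ s a, π θ s a ≠ 0)
    (hπ' : ∀ s a, Differentiable ℝ (logPolicy π s a)) (ω : ℕ → S × A)
    (θ : EuclideanSpace ℝ (Fin d)) :
    HasGradientAt (fun θ => M.isRatio (π θ) b ω) (M.isRatio (π θ) b ω • M.score π θ ω) θ := by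
  refine hasGradientAt_finset_prod _ fun t _ => ?_
  have hpolicy := (hasGradientAt_policy hπ hπ' (ω t).1 (ω t).2 θ).hasFDerivAt.mul_const
    ((b (ω t).1 (ω t).2).toReal)⁻¹
  rw [← map_smul, smul_smul, mul_comm] at hpolicy
  simpa only [div_eq_mul_inv, hasGradientAt_iff_hasFDerivAt] using hpolicy

lemma norm_score_le {Md c : ℝ} (hMd : ∀ θ s a, ‖gradient (logPolicy π s a) θ‖ ≤ Md)
    {ω : ℕ → S × A} (hc : (M.length ω : ℝ) ≤ c) (θ : EuclideanSpace ℝ (Fin d)) :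
    ‖M.score π θ ω‖ ≤ c * Md := by
  have hMd₀ : 0 ≤ Md := (norm_nonneg _).trans (hMd θ (ω 0).1 (ω 0).2)
  refine (norm_sum_le_of_le _ fun t _ => hMd θ _ _).trans ?_
  rw [Finset.sum_const, Finset.card_range, nsmul_eq_mul]
  gcongr

lemma differentiable_score (hπ' : ∀ s a, Differentiable ℝ (gradient (logPolicy π s a)))
    (ω : ℕ → S × A) : Differentiable ℝ (M.score π · ω) :=
  Differentiable.fun_sum fun _ _ => hπ' _ _

lemma norm_fderiv_score_le (hπ' : ∀ s a, Differentiable ℝ (gradient (logPolicy π s a))) {Mh c : ℝ}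
    (hMh : ∀ θ s a, ‖fderiv ℝ (gradient (logPolicy π s a)) θ‖ ≤ Mh) {ω : ℕ → S × A}
    (hc : (M.length ω : ℝ) ≤ c) (θ : EuclideanSpace ℝ (Fin d)) :
    ‖fderiv ℝ (M.score π · ω) θ‖ ≤ c * Mh := by
  have hMh₀ : 0 ≤ Mh := (norm_nonneg _).trans (hMh θ (ω 0).1 (ω 0).2)
  unfold score
  rw [fderiv_fun_sum fun t _ => hπ' _ _ θ]
  refine (norm_sum_le_of_le _ fun t _ => hMh θ _ _).trans ?_
  rw [Finset.sum_const, Finset.card_range, nsmul_eq_mul]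
  gcongr

lemma iterate_eq_ascentIterate {m N : ℕ} {b : S → PMF A} {g : ℝ → ℝ} {T : Type*}
    {e : EuclideanSpace ℝ (Fin d) → T → EuclideanSpace ℝ (Fin d)} {ξ : ℕ → Fin m → ℕ → S × A}
    {z : ℕ → T} (he : ∀ k < N, ∀ θ, M.drmGradEstimate π b g θ (ξ k) = e θ (z k)) (α : ℝ)
    (θ₀ : EuclideanSpace ℝ (Fin d)) {k : ℕ} (hk : k ≤ N) :
    M.iterate π b g α θ₀ ξ k = ascentIterate e α θ₀ k fun j => z j := by
  induction k with
  | zero => rfl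
  | succ k ih =>
    rw [iterate, he k hk, ih (Nat.le_of_succ_le hk)]
    rfl

variable [Fintype S] [Fintype A] [MeasurableSpace S] [DiscreteMeasurableSpace S]
  [MeasurableSpace A] [DiscreteMeasurableSpace A] {b : S → PMF A} {Md Mh Me Ms : ℝ}

/-- The standing assumptions on the policies: positivity, smoothness in the parameter with score
bound `Md` and Hessian bound `Mh`, and almost sure bounds `Me` and `Ms` on the episode length and on
the importance sampling ratio under the behavior policy. -/
structure IsRegular (M : EpisodicMDP S A) (π : EuclideanSpace ℝ (Fin d) → S → PMF A)
    (b : S → PMF A) (Md Mh Me Ms : ℝ) : Prop where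
  behavior_ne_zero : ∀ s a, b s a ≠ 0
  policy_ne_zero : ∀ θ s a, π θ s a ≠ 0
  differentiable_logPolicy : ∀ s a, Differentiable ℝ (logPolicy π s a)
  differentiable_gradient_logPolicy : ∀ s a, Differentiable ℝ (gradient (logPolicy π s a))
  norm_gradient_logPolicy_le : ∀ θ s a, ‖gradient (logPolicy π s a) θ‖ ≤ Md
  norm_fderiv_gradient_logPolicy_le : ∀ θ s a, ‖fderiv ℝ (gradient (logPolicy π s a)) θ‖ ≤ Mh
  ae_length_le : ∀ᵐ ω ∂M.law b M.start, M.Terminates ω ∧ (M.length ω : ℝ) ≤ Me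
  ae_isRatio_le : ∀ θ, ∀ᵐ ω ∂M.law b M.start, M.isRatio (π θ) b ω ≤ Ms

namespace IsRegular

lemma ae_terminatesBy (hM : M.IsRegular π b Md Mh Me Ms) :
    ∀ᵐ ω ∂M.law b M.start, M.TerminatesBy ⌊Me⌋₊ ω := by
  filter_upwards [hM.ae_length_le] with ω ⟨hterm, hlength⟩
  exact hterm.terminatesBy_floor hlength

lemma ae_pathLaw_length_le (hM : M.IsRegular π b Md Mh Me Ms) (a₀ : A) :
    ∀ᵐ h ∂M.pathLaw b a₀ ⌊Me⌋₊, (M.length (extendPath h) : ℝ) ≤ Me := by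
  rw [ae_pathLaw_iff]
  filter_upwards [hM.ae_length_le, hM.ae_terminatesBy] with ω hω hterm
  rw [length_extendPath_truncate a₀ hterm]
  exact hω.2

lemma ae_pathLaw_isRatio_le (hM : M.IsRegular π b Md Mh Me Ms) (a₀ : A)
    (θ : EuclideanSpace ℝ (Fin d)) :
    ∀ᵐ h ∂M.pathLaw b a₀ ⌊Me⌋₊, M.isRatio (π θ) b (extendPath h) ≤ Ms := by
  rw [ae_pathLaw_iff]
  filter_upwards [hM.ae_isRatio_le θ, hM.ae_terminatesBy] with ω hω hterm
  rwa [isRatio_extendPath_truncate a₀ hterm]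

/-- The importance sampling model of the episodes of the behavior policy. These terminate within
`⌊Me⌋₊` steps, so that finite paths suffice. -/
def importanceModel (hM : M.IsRegular π b Md Mh Me Ms) (a₀ : A) :
    ImportanceModel (Fin (⌊Me⌋₊ + 1) → S × A) (EuclideanSpace ℝ (Fin d)) where
  μ := M.pathLaw b a₀ ⌊Me⌋₊
  reward h := M.cumReward (extendPath h)
  ratio θ h := M.isRatio (π θ) b (extendPath h)
  score θ h := M.score π θ (extendPath h)
  ratioBound := Ms
  scoreBound := Me * Md
  scoreDerivBound := Me * Mh
  isProbabilityMeasure := inferInstance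
  ratio_nonneg _ _ := isRatio_nonneg _ _ _
  integral_ratio θ := by
    rw [← setIntegral_univ,
      setIntegral_isRatio_pathLaw _ hM.behavior_ne_zero a₀ hM.ae_terminatesBy, probReal_univ]
  ae_ratio_le := ae_iff_of_countable.2 fun h hh θ =>
    ae_iff_of_countable.1 (hM.ae_pathLaw_isRatio_le a₀ θ) h hh
  hasGradientAt_ratio θ _ :=
    hasGradientAt_isRatio b hM.policy_ne_zero hM.differentiable_logPolicy _ θ
  ae_norm_score_le := (hM.ae_pathLaw_length_le a₀).mono fun _ hlength =>
    norm_score_le hM.norm_gradient_logPolicy_le hlength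
  differentiable_score _ := differentiable_score hM.differentiable_gradient_logPolicy _
  ae_norm_fderiv_score_le := (hM.ae_pathLaw_length_le a₀).mono fun _ hlength =>
    norm_fderiv_score_le hM.differentiable_gradient_logPolicy
      hM.norm_fderiv_gradient_logPolicy_le hlength

variable (hM : M.IsRegular π b Md Mh Me Ms) (a₀ : A) {g : ℝ → ℝ} {C₁ C₂ : ℝ}
include hM

lemma rewardCDF_eq_cdf (θ : EuclideanSpace ℝ (Fin d)) (x : ℝ) :
    M.rewardCDF (π θ) x = (hM.importanceModel a₀).cdf θ x :=
  rewardCDF_eq_setIntegral_isRatio (π θ) hM.behavior_ne_zero a₀ hM.ae_terminatesBy x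

lemma drm_eq_integral_sub (g : ℝ → ℝ) (θ : EuclideanSpace ℝ (Fin d)) :
    M.drm g (π θ) = (∫ x in (-M.rewardBound)..M.rewardBound,
      g (1 - (hM.importanceModel a₀).cdf θ x)) - M.rewardBound := by
  have hint (u v : ℝ) : IntervalIntegrable (fun x => g (1 - (hM.importanceModel a₀).cdf θ x))
      volume u v :=
    intervalIntegrable_of_factorsThrough_sublevel (hM.importanceModel a₀).reward
      (fun x y (hxy : (hM.importanceModel a₀).sublevel x = (hM.importanceModel a₀).sublevel y) => by
        simp only [ImportanceModel.cdf, hxy]) u v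
  simp only [drm, hM.rewardCDF_eq_cdf a₀]
  rw [intervalIntegral.integral_sub (hint _ _) (by simp), intervalIntegral.integral_const,
    ← intervalIntegral.integral_add_adjacent_intervals (hint (-M.rewardBound) 0)
      (hint 0 M.rewardBound), smul_eq_mul]
  ring

lemma hasGradientAt_drm (hg : HasBoundedLipschitzDerivOn g (Icc 0 1) C₁ C₂)
    (θ : EuclideanSpace ℝ (Fin d)) :
    HasGradientAt (fun θ => M.drm g (π θ))
      ((hM.importanceModel a₀).riskGrad g M.rewardBound θ) θ := by
  rw [hasGradientAt_iff_hasFDerivAt]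
  simp only [hM.drm_eq_integral_sub a₀]
  exact ((hM.importanceModel a₀).hasGradientAt_integral_comp_cdf hg
    M.rewardBound θ).hasFDerivAt.sub_const _

lemma differentiable_drm (hg : HasBoundedLipschitzDerivOn g (Icc 0 1) C₁ C₂) :
    Differentiable ℝ fun θ => M.drm g (π θ) := fun θ =>
  let ⟨a₀⟩ : Nonempty A := (b M.start).support_nonempty.to_type
  (hM.hasGradientAt_drm a₀ hg θ).differentiableAt

lemma one_le_ratioBound : 1 ≤ Ms :=
  let ⟨a₀⟩ : Nonempty A := (b M.start).support_nonempty.to_type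
  (hM.importanceModel a₀).one_le_ratioBound

lemma bddAbove_range_drm (hg : ContinuousOn g (Icc 0 1)) :
    BddAbove (range fun θ => M.drm g (π θ)) := by
  obtain ⟨a₀⟩ : Nonempty A := (b M.start).support_nonempty.to_type
  obtain ⟨c, hc⟩ := isCompact_Icc.exists_bound_of_continuousOn hg
  refine ⟨c * |M.rewardBound - -M.rewardBound| - M.rewardBound, ?_⟩
  rintro _ ⟨θ, rfl⟩
  simp only [hM.drm_eq_integral_sub a₀]
  gcongr
  exact (Real.le_norm_self _).trans <| intervalIntegral.norm_integral_le_of_norm_le_const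
    fun x _ => hc _ ((hM.importanceModel a₀).one_sub_cdf_mem_Icc θ x)

lemma drmGradEstimate_eq_riskGradEst (g : ℝ → ℝ) {m : ℕ} (θ : EuclideanSpace ℝ (Fin d))
    {ω : Fin m → ℕ → S × A} (hω : ∀ i, M.TerminatesBy ⌊Me⌋₊ (ω i)) :
    M.drmGradEstimate π b g θ ω = (hM.importanceModel a₀).riskGradEst g M.rewardBound θ
      fun i => M.truncate a₀ ⌊Me⌋₊ (ω i) := by
  have hcdf (x : ℝ) : M.cdfEstimate π b θ ω x =
      (hM.importanceModel a₀).cdfEst θ (fun i => M.truncate a₀ ⌊Me⌋₊ (ω i)) x := by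
    simp only [cdfEstimate, ImportanceModel.cdfEst, ImportanceModel.uncappedCdfEst,
      ImportanceModel.sublevel, importanceModel, Set.indicator_apply, Set.mem_ofPred_eq,
      Fintype.card_fin, cumReward_extendPath_truncate a₀ (hω _),
      isRatio_extendPath_truncate a₀ (hω _)]
  have hgrad (x : ℝ) : M.cdfGradEstimate π b θ ω x =
      (hM.importanceModel a₀).cdfGradEst θ (fun i => M.truncate a₀ ⌊Me⌋₊ (ω i)) x := by
    simp only [cdfGradEstimate, ImportanceModel.cdfGradEst,
      ImportanceModel.sublevel, importanceModel, Set.indicator_apply, Set.mem_ofPred_eq,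
      Fintype.card_fin, cumReward_extendPath_truncate a₀ (hω _),
      isRatio_extendPath_truncate a₀ (hω _), score_extendPath_truncate a₀ (hω _)]
  simp only [drmGradEstimate, ImportanceModel.riskGradEst, hcdf, hgrad]

end IsRegular

/-- A run of the algorithm: `N` batches `ξ k` of `m` independent episodes of the behavior policy,
and an independent index `R`, uniform on `{1, …, N}`, which selects the returned iterate. -/
structure IsRun (M : EpisodicMDP S A) (b : S → PMF A) {Ω : Type*} [MeasurableSpace Ω] (N : ℕ)
    {m : ℕ} (ξ : ℕ → Fin m → Ω → ℕ → S × A) (R : Ω → ℕ) (P : Measure Ω) : Prop where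
  measurable_episode : ∀ k < N, ∀ i, Measurable (ξ k i)
  map_episode : ∀ k < N, ∀ i, P.map (ξ k i) = M.law b M.start
  iIndepFun_episode : iIndepFun (fun (j : Fin N × Fin m) => ξ j.1 j.2) P
  measurable_index : Measurable R
  index_law : ∀ k ∈ Finset.Icc 1 N, P {ω | R ω = k} = (N : ENNReal)⁻¹
  indepFun_index : IndepFun R (fun ω (j : Fin N × Fin m) => ξ j.1 j.2 ω) P

namespace IsRun

variable {Ω : Type*} [MeasurableSpace Ω] {P : Measure Ω} {N m : ℕ}
  {ξ : ℕ → Fin m → Ω → ℕ → S × A} {R : Ω → ℕ} (hξ : M.IsRun b N ξ R P)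
include hξ

lemma isSample_batch {k : ℕ} (hk : k < N) : IsSample (ξ k) (M.law b M.start) P where
  measurable := hξ.measurable_episode k hk
  map_eq := hξ.map_episode k hk
  indepFun i j hij :=
    hξ.iIndepFun_episode.indepFun (i := (⟨k, hk⟩, i)) (j := (⟨k, hk⟩, j)) (by simpa using hij)

lemma isSample_truncate (a₀ : A) (K : ℕ) {k : ℕ} (hk : k < N) :
    IsSample (fun i ω => M.truncate a₀ K (ξ k i ω)) (M.pathLaw b a₀ K) P :=
  (hξ.isSample_batch hk).comp (M.measurable_truncate a₀ K)

lemma indepFun_past_batch {k : ℕ} (hk : k < N) :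
    IndepFun (fun ω (j : Fin k) i => ξ j i ω) (fun ω i => ξ k i ω) P := by
  have hdisj : Disjoint (Finset.univ.filter fun j : Fin N × Fin m => (j.1 : ℕ) < k)
      (Finset.univ.filter fun j => (j.1 : ℕ) = k) :=
    Finset.disjoint_filter.2 fun _ _ hlt heq => hlt.ne heq
  have hindep := hξ.iIndepFun_episode.indepFun_finset _ _ hdisj fun j =>
    hξ.measurable_episode _ j.1.2 _
  refine hindep.comp (φ := fun u (j : Fin k) (i : Fin m) => u ⟨(⟨j, j.2.trans hk⟩, i), by simp⟩)
    (ψ := fun u (i : Fin m) => u ⟨(⟨k, hk⟩, i), by simp⟩) ?_ ?_ <;> fun_prop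

lemma indepFun_index_past {k : ℕ} (hk : k ≤ N) :
    IndepFun R (fun ω (j : Fin k) i => ξ j i ω) P :=
  hξ.indepFun_index.comp (φ := id)
    (ψ := fun (u : Fin N × Fin m → ℕ → S × A) (j : Fin k) (i : Fin m) => u (j.castLE hk, i))
    measurable_id (by fun_prop)

lemma ae_index_mem [IsProbabilityMeasure P] (hN : 0 < N) : ∀ᵐ ω ∂P, R ω ∈ Finset.Icc 1 N :=
  ae_mem_of_uniform (Finset.nonempty_Icc.2 hN) hξ.measurable_index
    (by rw [Nat.card_Icc, Nat.add_sub_cancel]; exact hξ.index_law)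

lemma isGradientOracle (hM : M.IsRegular π b Md Mh Me Ms) (a₀ : A) {g : ℝ → ℝ} {C₁ C₂ : ℝ}
    (hg : HasBoundedLipschitzDerivOn g (Icc 0 1) C₁ C₂) [IsProbabilityMeasure P]
    (hm : 0 < m) :
    IsGradientOracle ((hM.importanceModel a₀).riskGradEst g M.rewardBound)
      ((hM.importanceModel a₀).riskGrad g M.rewardBound)
      (fun k ω (i : Fin m) => M.truncate a₀ ⌊Me⌋₊ (ξ k i ω)) N P
      (2 * M.rewardBound * C₁ * (Ms * (Me * Md)))
      (8 * M.rewardBound ^ 2 * Ms ^ 2 * (Me * Md) ^ 2 * (C₁ ^ 2 + C₂ ^ 2) / m) where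
  measurable k hk := measurable_pi_lambda _ (hξ.isSample_truncate a₀ ⌊Me⌋₊ hk).measurable
  indepFun_past k hk := by
    have htrunc := M.measurable_truncate a₀ ⌊Me⌋₊
    exact (hξ.indepFun_past_batch hk).comp
      (φ := fun (u : Fin k → Fin m → ℕ → S × A) j i => M.truncate a₀ ⌊Me⌋₊ (u j i))
      (ψ := fun (u : Fin m → ℕ → S × A) i => M.truncate a₀ ⌊Me⌋₊ (u i))
      (by fun_prop) (by fun_prop)
  ae_norm_le k hk := by
    have := Fin.pos_iff_nonempty.1 hm
    have hsample := hξ.isSample_truncate a₀ ⌊Me⌋₊ hk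
    filter_upwards [hsample.ae_forall (hM.importanceModel a₀).ae_ratio_le,
      hsample.ae_forall (hM.importanceModel a₀).ae_norm_score_le] with ω hratio hscore θ
    exact (hM.importanceModel a₀).norm_riskGradEst_le hg M.rewardBound_pos.le
      (fun i => hratio i θ) fun i => hscore i θ
  integral_norm_sub_sq_le k hk θ := by
    have := Fin.pos_iff_nonempty.1 hm
    have hmse := (hM.importanceModel a₀).integral_norm_riskGradEst_sub_sq_le hg M.rewardBound_pos
      (hξ.isSample_truncate a₀ ⌊Me⌋₊ hk) θ
    rwa [Fintype.card_fin] at hmse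

lemma ae_iterate_eq_ascentIterate (hM : M.IsRegular π b Md Mh Me Ms) (a₀ : A) (g : ℝ → ℝ) (α : ℝ)
    (θ₀ : EuclideanSpace ℝ (Fin d)) :
    ∀ᵐ ω ∂P, ∀ k ≤ N, M.iterate π b g α θ₀ (fun k i => ξ k i ω) k =
      ascentIterate ((hM.importanceModel a₀).riskGradEst g M.rewardBound) α θ₀ k
        fun j i => M.truncate a₀ ⌊Me⌋₊ (ξ j i ω) := by
  have hterm : ∀ᵐ ω ∂P, ∀ k < N, ∀ i, M.TerminatesBy ⌊Me⌋₊ (ξ k i ω) := by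
    simp only [ae_all_iff (ι := ℕ), Filter.eventually_imp_distrib_left]
    exact fun k hk => (hξ.isSample_batch hk).ae_forall hM.ae_terminatesBy
  filter_upwards [hterm] with ω hω k hk
  exact iterate_eq_ascentIterate
    (z := fun k i => M.truncate a₀ ⌊Me⌋₊ (ξ k i ω))
    (fun k hk θ => hM.drmGradEstimate_eq_riskGradEst a₀ g θ (hω k hk)) α θ₀ hk

theorem integral_norm_gradient_drm_sq_le (hM : M.IsRegular π b Md Mh Me Ms) {g : ℝ → ℝ}
    {C₁ C₂ : ℝ} (hg : HasBoundedLipschitzDerivOn g (Icc 0 1) C₁ C₂) [IsProbabilityMeasure P]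
    (hN : 0 < N) (hm : 0 < m) {α : ℝ} (hα : 0 < α) (θ₀ : EuclideanSpace ℝ (Fin d)) :
    let ρ : EuclideanSpace ℝ (Fin d) → ℝ := fun θ => M.drm g (π θ)
    let L : ℝ := 2 * M.rewardBound * (C₁ * (Me * Mh + (Me * Md) ^ 2) + C₂ * (Me * Md) ^ 2)
    let θ : Ω → EuclideanSpace ℝ (Fin d) := fun ω =>
      M.iterate π b g α θ₀ (fun k i => ξ k i ω) (R ω)
    Integrable (fun ω => ‖gradient ρ (θ ω)‖ ^ 2) P ∧
    ∫ ω, ‖gradient ρ (θ ω)‖ ^ 2 ∂P ≤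
      2 * ((⨆ θ', ρ θ') - ρ θ₀) / (N * α) +
        8 * M.rewardBound ^ 2 * Ms ^ 2 * (Me * Md) ^ 2 * (C₁ ^ 2 + C₂ ^ 2) / m +
        L * α * (2 * M.rewardBound * C₁ * (Ms * (Me * Md))) ^ 2 +
        (2 * M.rewardBound * C₁ * (Me * Md)) ^ 2 / N := by
  intro ρ L θ
  obtain ⟨a₀⟩ : Nonempty A := (b M.start).support_nonempty.to_type
  let I := hM.importanceModel a₀
  have hr : 0 ≤ M.rewardBound := M.rewardBound_pos.le
  have hgrad : ∀ θ, HasGradientAt ρ (I.riskGrad g M.rewardBound θ) θ := hM.hasGradientAt_drm a₀ hg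
  have hbdd : BddAbove (range ρ) := hM.bddAbove_range_drm hg.differentiableOn.continuousOn
  have htrunc := M.measurable_truncate a₀ ⌊Me⌋₊
  have hindex (k : ℕ) (hk : k ≤ N) :
      IndepFun R (fun ω (j : Fin k) (i : Fin m) => M.truncate a₀ ⌊Me⌋₊ (ξ j i ω)) P :=
    (hξ.indepFun_index_past hk).comp (φ := id)
      (ψ := fun (u : Fin k → Fin m → ℕ → S × A) j i => M.truncate a₀ ⌊Me⌋₊ (u j i))
      measurable_id (by fun_prop)
  obtain ⟨hint, hle⟩ := (hξ.isGradientOracle hM a₀ hg hm).integral_norm_sq_uniform_index_le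
    (θ₀ := θ₀) hgrad (I.lipschitzConst_riskGrad_nonneg hg hr) (I.norm_riskGrad_sub_le hg hr) hα
    (fun θ => le_ciSup hbdd θ) (I.norm_riskGrad_le hg hr) hN hξ.measurable_index hξ.index_law hindex
  have hiterate : (fun ω => ‖gradient ρ (θ ω)‖ ^ 2) =ᵐ[P] fun ω =>
      ‖I.riskGrad g M.rewardBound (ascentIterate (I.riskGradEst g M.rewardBound) α θ₀ (R ω)
        fun j i => M.truncate a₀ ⌊Me⌋₊ (ξ j i ω))‖ ^ 2 := by
    filter_upwards [hξ.ae_iterate_eq_ascentIterate hM a₀ g α θ₀, hξ.ae_index_mem hN] with ω hω hR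
    rw [(hgrad _).gradient]
    simp only [θ, hω _ (Finset.mem_Icc.1 hR).2]
    rfl
  exact ⟨(integrable_congr hiterate).2 hint, (integral_congr_ae hiterate).trans_le hle⟩

end IsRun

end EpisodicMDP

/-- Each of the three error terms is of order `1 / √N` at step size `1 / √N` and batch size at least
`√N`, and the variance and the last iterate use only part of the final constant. -/
lemma ascent_error_le {r Ms B C₁ C₂ L N m : ℝ} (hMs : 1 ≤ Ms) (hN : 1 ≤ N) (hm : √N ≤ m) :
    8 * r ^ 2 * Ms ^ 2 * B ^ 2 * (C₁ ^ 2 + C₂ ^ 2) / m +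
        L * (1 / √N) * (2 * r * C₁ * (Ms * B)) ^ 2 + (2 * r * C₁ * B) ^ 2 / N ≤
      4 * r ^ 2 * Ms ^ 2 * B ^ 2 *
        (C₁ ^ 2 * L + 8 * (Real.exp 1 ^ 2 * C₁ ^ 2 + C₂ ^ 2 * Ms ^ 2)) / √N := by
  have : 1 ≤ √N := Real.one_le_sqrt.2 hN
  have hsN : √N ≤ N := Real.sqrt_le_iff.2 ⟨by linarith, by nlinarith⟩
  have hMs₂ : 1 ≤ Ms ^ 2 := one_le_pow₀ hMs
  have he : 1 ≤ Real.exp 1 ^ 2 := one_le_pow₀ (Real.one_le_exp zero_le_one)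
  set V := Real.exp 1 ^ 2 * C₁ ^ 2 + C₂ ^ 2 * Ms ^ 2
  have hsum : C₁ ^ 2 + C₂ ^ 2 ≤ V :=
    add_le_add (le_mul_of_one_le_left (sq_nonneg _) he) (le_mul_of_one_le_right (sq_nonneg _) hMs₂)
  have hC₁ : C₁ ^ 2 ≤ 6 * V := by linarith [sq_nonneg C₁, sq_nonneg C₂]
  calc _ ≤ 8 * r ^ 2 * Ms ^ 2 * B ^ 2 * (C₁ ^ 2 + C₂ ^ 2) / √N +
          L * (1 / √N) * (2 * r * C₁ * (Ms * B)) ^ 2 + (2 * r * C₁ * B) ^ 2 / √N := by gcongr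
    _ = (4 * r ^ 2 * Ms ^ 2 * B ^ 2 * (C₁ ^ 2 * L + 2 * (C₁ ^ 2 + C₂ ^ 2)) +
          4 * r ^ 2 * 1 * B ^ 2 * C₁ ^ 2) / √N := by ring
    _ ≤ (4 * r ^ 2 * Ms ^ 2 * B ^ 2 * (C₁ ^ 2 * L + 2 * V) +
          4 * r ^ 2 * Ms ^ 2 * B ^ 2 * (6 * V)) / √N := by gcongr
    _ = _ := by ring

theorem mainTheorem5_general
    {S A : Type*} [Fintype S] [Fintype A]
    [MeasurableSpace S] [DiscreteMeasurableSpace S]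
    [MeasurableSpace A] [DiscreteMeasurableSpace A]
    {M : EpisodicMDP S A} {d : ℕ}
    {π : EuclideanSpace ℝ (Fin d) → S → PMF A} {b : S → PMF A} {g : ℝ → ℝ}
    {Mg' Mg'' Md Mh Me Ms : ℝ} (hg : HasBoundedLipschitzDerivOn g (Icc 0 1) Mg' Mg'')
    (hM : M.IsRegular π b Md Mh Me Ms)
    {N m : ℕ} (hN : 0 < N) (hm : √(N : ℝ) ≤ m) (θ₀ : EuclideanSpace ℝ (Fin d))
    {Ω : Type*} [MeasurableSpace Ω] {P : Measure Ω} [IsProbabilityMeasure P]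
    {ξ : ℕ → Fin m → Ω → ℕ → S × A} {R : Ω → ℕ} (hξ : M.IsRun b N ξ R P) :
    let ρ : EuclideanSpace ℝ (Fin d) → ℝ := fun θ => M.drm g (π θ)
    let Mr : ℝ := M.rewardBound
    let L : ℝ := 2 * Mr * Me * (Mh * Mg' + Me * Md ^ 2 * (Mg' + Mg''))
    let θ : Ω → ℕ → EuclideanSpace ℝ (Fin d) := fun ω =>
      M.iterate π b g (1 / √(N : ℝ)) θ₀ (fun k i => ξ k i ω)
    Differentiable ℝ ρ ∧ BddAbove (range ρ) ∧
    Integrable (fun ω => ‖gradient ρ (θ ω (R ω))‖ ^ 2) P ∧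
    ∫ ω, ‖gradient ρ (θ ω (R ω))‖ ^ 2 ∂P ≤
      2 * ((⨆ θ', ρ θ') - ρ θ₀) / √(N : ℝ) +
      4 * Mr ^ 2 * Ms ^ 2 * Me ^ 2 * Md ^ 2 *
        (Mg' ^ 2 * L + 8 * (Real.exp 1 ^ 2 * Mg' ^ 2 + Mg'' ^ 2 * Ms ^ 2)) / √(N : ℝ) := by
  intro ρ Mr L θ
  have hs : 0 < √(N : ℝ) := Real.sqrt_pos.2 (Nat.cast_pos.2 hN)
  have hm₀ : 0 < m := Nat.cast_pos.1 (hs.trans_le hm)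
  obtain ⟨hint, hle⟩ := hξ.integral_norm_gradient_drm_sq_le hM hg hN hm₀ (one_div_pos.2 hs) θ₀
  refine ⟨hM.differentiable_drm hg, hM.bddAbove_range_drm hg.differentiableOn.continuousOn, hint,
    hle.trans ?_⟩
  have herror := ascent_error_le (r := Mr) (B := Me * Md) (C₁ := Mg') (C₂ := Mg'') (L := L)
    hM.one_le_ratioBound (Nat.one_le_cast.2 hN) hm
  have hstep : (N : ℝ) * (1 / √(N : ℝ)) = √(N : ℝ) := by rw [mul_one_div, Real.div_sqrt]
  rw [hstep]
  simp only [L, Mr] at herror ⊢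
  linear_combination herror

end

theorem mainTheorem5
    {S A : Type*} [Fintype S] [Fintype A]
    [MeasurableSpace S] [DiscreteMeasurableSpace S]
    [MeasurableSpace A] [DiscreteMeasurableSpace A]
    (M : EpisodicMDP S A) {d : ℕ}
    -- the parameterized policies and the behavior policy
    (π : EuclideanSpace ℝ (Fin d) → S → PMF A) (b : S → PMF A)
    -- the distortion function
    (g : ℝ → ℝ) (hg0 : g 0 = 0) (hg1 : g 1 = 1)
    (hg_mono : MonotoneOn g (Set.Icc 0 1)) (hg_cont : ContinuousOn g (Set.Icc 0 1))
    (hg_diff : DifferentiableOn ℝ g (Set.Ioo 0 1))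
    (hg_diff2 : DifferentiableOn ℝ (deriv g) (Set.Ioo 0 1))
    (Mg' Mg'' : ℝ)
    (hMg' : ∀ t ∈ Set.Ioo (0 : ℝ) 1, |deriv g t| ≤ Mg')
    (hMg'' : ∀ t ∈ Set.Ioo (0 : ℝ) 1, |deriv (deriv g) t| ≤ Mg'')
    -- all policies are proper
    (hπ_proper : ∃ n : ℕ, 0 < n ∧ ∀ θ s, M.law (π θ) s {ω | (ω n).1 ≠ M.terminal} < 1)
    (hb_proper : ∃ n : ℕ, 0 < n ∧ ∀ s, M.law b s {ω | (ω n).1 ≠ M.terminal} < 1)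
    -- the policies are positive and smooth in the parameter, and dominated by the behavior policy
    (hπ_pos : ∀ θ s a, π θ s a ≠ 0)
    (hπ_ac : ∀ θ s a, b s a = 0 → π θ s a = 0)
    (hπ_diff : ∀ s a, Differentiable ℝ (EpisodicMDP.logPolicy π s a))
    (hπ_diff2 : ∀ s a, Differentiable ℝ (gradient (EpisodicMDP.logPolicy π s a)))
    (Md Mh : ℝ)
    (hMd : ∀ θ s a, ‖gradient (EpisodicMDP.logPolicy π s a) θ‖ ≤ Md)
    (hMh : ∀ θ s a, ‖fderiv ℝ (gradient (EpisodicMDP.logPolicy π s a)) θ‖ ≤ Mh)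
    -- almost sure bounds on the episode length and on the importance sampling ratio
    (Me Ms : ℝ)
    (hMe : ∀ᵐ ω ∂M.law b M.start, M.Terminates ω ∧ (M.length ω : ℝ) ≤ Me)
    (hMs : ∀ θ, ∀ᵐ ω ∂M.law b M.start, M.isRatio (π θ) b ω ≤ Ms)
    -- a run of the algorithm: `N` batches of `m` independent episodes of `b`, and a random index
    (N m : ℕ) (hN : 0 < N) (hm : m = ⌈√(N : ℝ)⌉₊) (θ₀ : EuclideanSpace ℝ (Fin d))
    {Ω : Type*} [MeasurableSpace Ω] (P : Measure Ω) [IsProbabilityMeasure P]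
    (ξ : ℕ → Fin m → Ω → ℕ → S × A)
    (hξ_meas : ∀ k < N, ∀ i, Measurable (ξ k i))
    (hξ_law : ∀ k < N, ∀ i, P.map (ξ k i) = M.law b M.start)
    (hξ_indep : iIndepFun (fun (j : Fin N × Fin m) => ξ j.1 j.2) P)
    (R : Ω → ℕ) (hR_meas : Measurable R)
    (hR_law : ∀ k ∈ Finset.Icc 1 N, P {w | R w = k} = (N : ENNReal)⁻¹)
    (hR_indep : IndepFun R (fun w (j : Fin N × Fin m) => ξ j.1 j.2 w) P) :
    let ρ : EuclideanSpace ℝ (Fin d) → ℝ := fun θ => M.drm g (π θ)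
    let Mr : ℝ := M.rewardBound
    let L : ℝ := 2 * Mr * Me * (Mh * Mg' + Me * Md ^ 2 * (Mg' + Mg''))
    let θ : Ω → ℕ → EuclideanSpace ℝ (Fin d) := fun w =>
      M.iterate π b g (1 / √(N : ℝ)) θ₀ (fun k i => ξ k i w)
    Differentiable ℝ ρ ∧ BddAbove (Set.range ρ) ∧
    Integrable (fun w => ‖gradient ρ (θ w (R w))‖ ^ 2) P ∧
    ∫ w, ‖gradient ρ (θ w (R w))‖ ^ 2 ∂P ≤
      2 * ((⨆ θ', ρ θ') - ρ θ₀) / √(N : ℝ) +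
      4 * Mr ^ 2 * Ms ^ 2 * Me ^ 2 * Md ^ 2 *
        (Mg' ^ 2 * L + 8 * (Real.exp 1 ^ 2 * Mg' ^ 2 + Mg'' ^ 2 * Ms ^ 2)) / √(N : ℝ) :=
  mainTheorem5_general
    (hasBoundedLipschitzDerivOn_Icc zero_lt_one hg_cont hg_diff hg_diff2 hMg' hMg'')
    ⟨fun s a h => hπ_pos 0 s a (hπ_ac 0 s a h), hπ_pos, hπ_diff, hπ_diff2, hMd, hMh, hMe, hMs⟩
    hN (hm ▸ Nat.le_ceil _) θ₀ ⟨hξ_meas, hξ_law, hξ_indep, hR_meas, hR_law, hR_indep⟩
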